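/- For a finite graph $G$ on a vertex set $V$, a box representation of $G$ of dimension $d$ is a family of interval graphs $I_1,\dots,I_d$ on $V$, each given by nonempty closed real intervals $[l_i(v),r_i(v)]$, $v\in V$, such that $E(G)=E(I_1)\cap\dots\cap E(I_d)$ (for $d=0$ the intersection is the edge set of the complete graph on $V$). The boxicity $\operatorname{box}(G)$ is the minimum dimension of a box representation of $G$ (so it is $0$ for complete graphs), and a box representation of dimension $\operatorname{box}(G)$ is called optimal. **Theorem.** Let $G$ be a graph on $n$ vertices containing a clique of size $n-k$ or more. Then $\operatorname{box}(G)\le k$, and an optimal box representation of $G$ can be found in time $n^2\,2^{O(k^2\log k)}$. That is, there are one program for the unit-cost random access machine (operations: addition, truncated subtraction, zero test, indirect addressing, on natural numbers) and one constant $C$ such that for every $n\ge 1$ and every graph $G$ on the vertices $0,\dots,n-1$, given by $n$ and its adjacency matrix, the program halts with $\operatorname{box}(G)$ and the end points of the intervals of an optimal box representation of $G$ as output, and for every $k\ge 0$ such that $G$ contains a clique of size at least $n-k$ its number of steps is at most $C\,n^2\,2^{C k^2\log_2 k}$ (where $k^2\log_2 k$ is read as $0$ for $k=0$). -/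

import Mathlib

namespace Boxicity

/-! ### Interval graphs, box representations, boxicity -/

/-- The intersection graph of the closed real intervals `[l v, r v]`, `v ∈ V`. -/
def intervalGraph {V : Type*} (l r : V → ℝ) : SimpleGraph V where
  Adj u v := u ≠ v ∧ (Set.Icc (l u) (r u) ∩ Set.Icc (l v) (r v)).Nonempty
  symm := ⟨fun _ _ h => ⟨h.1.symm, by rw [Set.inter_comm]; exact h.2⟩⟩
  loopless := ⟨fun _ h => h.1 rfl⟩

/-- The (nonempty) intervals `[l i v, r i v]`, `i < d`, form a box representation of `G` of
dimension `d`: the edge set of `G` is the intersection of the edge sets of the `d` interval graphs.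
For `d = 0` the empty intersection is the complete graph. -/
def IsBoxRep {V : Type*} (G : SimpleGraph V) (d : ℕ) (l r : Fin d → V → ℝ) : Prop :=
  (∀ i v, l i v ≤ r i v) ∧ G = ⨅ i, intervalGraph (l i) (r i)

/-- The boxicity of `G`: the least dimension of a box representation (`⊤` if there is none). -/
noncomputable def boxicity {V : Type*} (G : SimpleGraph V) : ℕ∞ :=
  sInf {d : ℕ∞ | ∃ m : ℕ, d = m ∧ ∃ l r : Fin m → V → ℝ, IsBoxRep G m l r}

/-! ### Unit-cost random access machine

Programs are structured (sequence, conditional, while loop). The store consists of registers and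
arrays, all holding natural numbers; a program mentions finitely many of them by name, and array
cells are addressed by computed values. The arithmetic is addition and truncated subtraction
only (no multiplication), and every elementary operation costs one step. -/

/-- The store of the machine: registers and arrays, named by natural numbers. -/
structure Store where
  /-- content of a register -/
  reg : ℕ → ℕ
  /-- content of a cell of an array -/
  arr : ℕ → ℕ → ℕ

/-- Arithmetic expressions; `get a e` is the cell of the array `a` whose index is the value
of `e`. -/
inductive RExpr : Type
  | const (c : ℕ)
  | reg (x : ℕ)
  | get (a : ℕ) (e : RExpr)
  | add (e₁ e₂ : RExpr)
  | sub (e₁ e₂ : RExpr)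

/-- The value of an expression in a store. -/
def RExpr.eval (s : Store) : RExpr → ℕ
  | .const c => c
  | .reg x => s.reg x
  | .get a e => s.arr a (e.eval s)
  | .add e₁ e₂ => e₁.eval s + e₂.eval s
  | .sub e₁ e₂ => e₁.eval s - e₂.eval s

/-- The number of elementary operations in the evaluation of an expression. -/
def RExpr.cost : RExpr → ℕ
  | .const _ => 1
  | .reg _ => 1
  | .get _ e => e.cost + 1
  | .add e₁ e₂ => e₁.cost + e₂.cost + 1
  | .sub e₁ e₂ => e₁.cost + e₂.cost + 1

/-- Programs. A test `e` succeeds if the value of `e` is nonzero. -/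
inductive Prog : Type
  | skip
  | set (x : ℕ) (e : RExpr)
  | put (a : ℕ) (i e : RExpr)
  | seq (p q : Prog)
  | ite (e : RExpr) (p q : Prog)
  | loop (e : RExpr) (p : Prog)

/-- Assign a value to a register. -/
def Store.setReg (s : Store) (x v : ℕ) : Store :=
  { s with reg := Function.update s.reg x v }

/-- Assign a value to an array cell. -/
def Store.setArr (s : Store) (a i v : ℕ) : Store :=
  { s with arr := Function.update s.arr a (Function.update (s.arr a) i v) }

/-- `Run p s t s'`: started in the store `s`, the program `p` halts after exactly `t` steps in the
store `s'`. -/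
inductive Run : Prog → Store → ℕ → Store → Prop
  | skip (s : Store) : Run .skip s 1 s
  | set (s : Store) (x : ℕ) (e : RExpr) :
      Run (.set x e) s (e.cost + 1) (s.setReg x (e.eval s))
  | put (s : Store) (a : ℕ) (i e : RExpr) :
      Run (.put a i e) s (i.cost + e.cost + 1) (s.setArr a (i.eval s) (e.eval s))
  | seq {p q : Prog} {s s' s'' : Store} {t t' : ℕ} :
      Run p s t s' → Run q s' t' s'' → Run (.seq p q) s (t + t') s''
  | ite_true {e : RExpr} {p q : Prog} {s s' : Store} {t : ℕ} :
      e.eval s ≠ 0 → Run p s t s' → Run (.ite e p q) s (e.cost + 1 + t) s'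
  | ite_false {e : RExpr} {p q : Prog} {s s' : Store} {t : ℕ} :
      e.eval s = 0 → Run q s t s' → Run (.ite e p q) s (e.cost + 1 + t) s'
  | loop_true {e : RExpr} {p : Prog} {s s' s'' : Store} {t t' : ℕ} :
      e.eval s ≠ 0 → Run p s t s' → Run (.loop e p) s' t' s'' →
        Run (.loop e p) s (e.cost + 1 + t + t') s''
  | loop_false {e : RExpr} {p : Prog} {s : Store} :
      e.eval s = 0 → Run (.loop e p) s (e.cost + 1) s

/-! ### Input and output -/

open Classical in
/-- The input store for a graph on the vertices `0, …, n - 1`: register `0` holds `n`, array `0`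
holds the adjacency matrix row by row, and everything else is `0`. -/
noncomputable def inputStore {n : ℕ} (G : SimpleGraph (Fin n)) : Store where
  reg x := if x = 0 then n else 0
  arr a m := if a = 0 ∧ ∃ u v : Fin n, G.Adj u v ∧ m = (u : ℕ) * n + v then 1 else 0

/-- The store holds an optimal box representation of `G`: register `0` holds `box G`, and, for
`i < box G`, the interval of the vertex `v` in the `i`-th interval graph has its left and right end
points in the cell `i * n + v` of the arrays `1` and `2`. -/
def HoldsOptimalBoxRep {n : ℕ} (G : SimpleGraph (Fin n)) (s : Store) : Prop :=
  (s.reg 0 : ℕ∞) = boxicity G ∧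
    IsBoxRep G (s.reg 0)
      (fun i v => (s.arr 1 ((i : ℕ) * n + v) : ℝ)) (fun i v => (s.arr 2 ((i : ℕ) * n + v) : ℝ))

end Boxicity

/-! If the vertices outside `A` form a clique, one interval graph per vertex of `A` separates that
vertex from its non-neighbours, so the boxicity is at most `|A|` (`exists_isBoxRep_card`).

The algorithm finds such a set without knowing `k` or a large clique: it marks the vertices of a
maximal matching in the complement. The unmarked vertices form a clique, and every clique misses a
vertex of each matched pair, so `m = |A| ≤ 2k` for every admissible `k` (`HalfFree.card_le`).

In each dimension the intervals of the unmarked vertices share a point `p`. Only the relative order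
of `p` and the at most `2m` end points belonging to `A` matters, so these can be moved to integers
in `0, …, 4m` with `p` at `2m`. Every other interval can then be shrunk to the least one that
contains `2m` and meets the intervals of its neighbours in `A` (`exists_integral`). Hence a
representation of dimension `d` is coded by `2dm` digits in base `4m + 1` (`exists_candidate`), and
trying all codes for `d = 0, …, m` finds an optimal one (`searchCmd_ok`).

For the running time, the algorithm is written with counted loops and bounded sums only and compiled
to the machine (`Cmd.run_code`). Each loop or sum is bounded by `n` or by a number `W` depending on
`m` alone. The time is then at most a constant times `n^a * W^b`, with `a` and `b` the nesting
depths of the two kinds (`Cmd.bound_le`). Here `a = 2`, and `W = roundBound m` has an exponent of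
order `m^2`. -/

namespace Boxicity

/-! ### Reading a store after an assignment -/

@[simp] theorem Store.setReg_reg (s : Store) (x v y : ℕ) :
    (s.setReg x v).reg y = if y = x then v else s.reg y := by
  simp [Store.setReg, Function.update_apply]

@[simp] theorem Store.setReg_arr (s : Store) (x v : ℕ) : (s.setReg x v).arr = s.arr := rfl

@[simp] theorem Store.setArr_reg (s : Store) (a i v : ℕ) : (s.setArr a i v).reg = s.reg := rfl

theorem Store.setArr_arr (s : Store) (a i v b j : ℕ) :
    (s.setArr a i v).arr b j = if b = a ∧ j = i then v else s.arr b j := by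
  by_cases hb : b = a
  · subst hb
    simp [Store.setArr, Function.update_apply]
  · simp [Store.setArr, hb]

theorem Store.setArr_arr_of_ne (s : Store) {a b : ℕ} (i v : ℕ) (h : b ≠ a) :
    (s.setArr a i v).arr b = s.arr b := by
  simp [Store.setArr, h]

/-! ### Terms with bounded sums

A term is evaluated without side effects. The Boolean of a sum says which of two given numbers,
`n` or `W`, bounds the number of summands; it matters for the cost only. -/

/-- Terms over the registers and arrays of a store; `sum b x e f` is the sum of the values of `f`,
where the register `x` runs through the numbers below the value of `e`. -/
inductive Tm : Type
  | const (c : ℕ)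
  | var (x : ℕ)
  | get (a : ℕ) (e : Tm)
  | add (e f : Tm)
  | sub (e f : Tm)
  | sum (b : Bool) (x : ℕ) (e f : Tm)

namespace Tm

/-- The value of a term. -/
def eval : Tm → Store → ℕ
  | const c, _ => c
  | var x, s => s.reg x
  | get a e, s => s.arr a (e.eval s)
  | add e f, s => e.eval s + f.eval s
  | sub e f, s => e.eval s - f.eval s
  | sum _ x e f, s => ∑ i ∈ Finset.range (e.eval s), f.eval (s.setReg x i)

/-- Free variables are below `k`, and sums bind the variables `k`, `k + 1`, … in their order
of nesting. -/
def inScope : Tm → ℕ → Bool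
  | const _, _ => true
  | var x, k => decide (x < k)
  | get _ e, k => e.inScope k
  | add e f, k => e.inScope k && f.inScope k
  | sub e f, k => e.inScope k && f.inScope k
  | sum _ x e f, k => decide (x = k) && e.inScope k && f.inScope (k + 1)

/-- All sums have at most as many summands as their flags promise. -/
def Fits (n W : ℕ) : Tm → Store → Prop
  | const _, _ => True
  | var _, _ => True
  | get _ e, s => e.Fits n W s
  | add e f, s => e.Fits n W s ∧ f.Fits n W s
  | sub e f, s => e.Fits n W s ∧ f.Fits n W s
  | sum b x e f, s => e.Fits n W s ∧ e.eval s ≤ cond b n W ∧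
      ∀ i < e.eval s, f.Fits n W (s.setReg x i)

/-- A program that computes the value of a term in the register `2 * j + 1`. The variable `x` is
held in the register `2 * x`, and the registers `2 * i + 1` with `i < j` are left alone. -/
def code : Tm → ℕ → Prog
  | const c, j => .set (2 * j + 1) (.const c)
  | var x, j => .set (2 * j + 1) (.reg (2 * x))
  | get a e, j => .seq (e.code j) (.set (2 * j + 1) (.get a (.reg (2 * j + 1))))
  | add e f, j => .seq (e.code j) (.seq (f.code (j + 1))
      (.set (2 * j + 1) (.add (.reg (2 * j + 1)) (.reg (2 * (j + 1) + 1)))))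
  | sub e f, j => .seq (e.code j) (.seq (f.code (j + 1))
      (.set (2 * j + 1) (.sub (.reg (2 * j + 1)) (.reg (2 * (j + 1) + 1)))))
  | sum _ x e f, j => .seq (e.code j) (.seq (.set (2 * (j + 1) + 1) (.const 0))
      (.seq (.set (2 * (j + 2) + 1) (.const 0))
      (.seq (.loop (.sub (.reg (2 * j + 1)) (.reg (2 * (j + 1) + 1)))
        (.seq (.set (2 * x) (.reg (2 * (j + 1) + 1))) (.seq (f.code (j + 3))
        (.seq (.set (2 * (j + 2) + 1) (.add (.reg (2 * (j + 2) + 1)) (.reg (2 * (j + 3) + 1))))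
          (.set (2 * (j + 1) + 1) (.add (.reg (2 * (j + 1) + 1)) (.const 1)))))))
      (.set (2 * j + 1) (.reg (2 * (j + 2) + 1))))))

/-- A bound on the running time of the code of a term. -/
def bound (n W : ℕ) : Tm → ℕ
  | const _ => 2
  | var _ => 2
  | get _ e => e.bound n W + 3
  | add e f => e.bound n W + f.bound n W + 4
  | sub e f => e.bound n W + f.bound n W + 4
  | sum b _ e f => e.bound n W + 10 + cond b n W * (f.bound n W + 14)

end Tm

/-! ### Commands -/

/-- Commands; `loop b x e p` executes `p` for all values of the register `x` below the value
of `e` at the start, with a flag `b` as for sums. -/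
inductive Cmd : Type
  | set (x : ℕ) (e : Tm)
  | put (a : ℕ) (i e : Tm)
  | seq (p q : Cmd)
  | loop (b : Bool) (x : ℕ) (e : Tm) (p : Cmd)

/-- The store after `i` rounds of a loop with the counter `x`. -/
def Store.rounds (f : Store → Store) (x : ℕ) (s : Store) : ℕ → Store
  | 0 => s
  | i + 1 => f ((s.rounds f x i).setReg x i)

namespace Cmd

/-- The effect of a command. -/
def exec : Cmd → Store → Store
  | set x e, s => s.setReg x (e.eval s)
  | put a i e, s => s.setArr a (i.eval s) (e.eval s)
  | seq p q, s => q.exec (p.exec s)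
  | loop _ x e p, s => s.rounds p.exec x (e.eval s)

/-- All variables are below `k`, apart from those bound by sums. -/
def inScope : Cmd → ℕ → Bool
  | set x e, k => decide (x < k) && e.inScope k
  | put _ i e, k => i.inScope k && e.inScope k
  | seq p q, k => p.inScope k && q.inScope k
  | loop _ x e p, k => decide (x < k) && e.inScope k && p.inScope k

/-- All loops and sums have at most as many rounds as their flags promise. -/
def Fits (n W : ℕ) : Cmd → Store → Prop
  | set _ e, s => e.Fits n W s
  | put _ i e, s => i.Fits n W s ∧ e.Fits n W s
  | seq p q, s => p.Fits n W s ∧ q.Fits n W (p.exec s)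
  | loop b x e p, s => e.Fits n W s ∧ e.eval s ≤ cond b n W ∧
      ∀ i < e.eval s, p.Fits n W ((s.rounds p.exec x i).setReg x i)

/-- The program of a command, with temporary registers from `2 * j + 1` on. -/
def code : Cmd → ℕ → Prog
  | set x e, j => .seq (e.code j) (.set (2 * x) (.reg (2 * j + 1)))
  | put a i e, j => .seq (i.code j) (.seq (e.code (j + 1))
      (.put a (.reg (2 * j + 1)) (.reg (2 * (j + 1) + 1))))
  | seq p q, j => .seq (p.code j) (q.code j)
  | loop _ x e p, j => .seq (e.code j) (.seq (.set (2 * (j + 1) + 1) (.const 0))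
      (.loop (.sub (.reg (2 * j + 1)) (.reg (2 * (j + 1) + 1)))
        (.seq (.set (2 * x) (.reg (2 * (j + 1) + 1))) (.seq (p.code (j + 2))
          (.set (2 * (j + 1) + 1) (.add (.reg (2 * (j + 1) + 1)) (.const 1)))))))

/-- A bound on the running time of the code of a command. -/
def bound (n W : ℕ) : Cmd → ℕ
  | set _ e => e.bound n W + 2
  | put _ i e => i.bound n W + e.bound n W + 3
  | seq p q => p.bound n W + q.bound n W
  | loop b _ e p => e.bound n W + 6 + cond b n W * (p.bound n W + 10)

end Cmd

/-! ### Correctness of the translation -/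

/-- The machine store `M` represents the store `s` as far as the variables below `k` go. -/
structure Sim (k : ℕ) (M s : Store) : Prop where
  arr : M.arr = s.arr
  reg : ∀ x < k, M.reg (2 * x) = s.reg x

theorem Sim.setReg_odd {k : ℕ} {M s : Store} (h : Sim k M s) (j v : ℕ) :
    Sim k (M.setReg (2 * j + 1) v) s :=
  ⟨h.arr, fun x hx => by rw [Store.setReg_reg, if_neg (by omega), h.reg x hx]⟩

theorem Sim.setReg_even {k : ℕ} {M s : Store} (h : Sim k M s) (x v : ℕ) :
    Sim k (M.setReg (2 * x) v) (s.setReg x v) :=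
  ⟨h.arr, fun y hy => by simp [h.reg y hy]⟩

theorem Sim.bind {k : ℕ} {M s : Store} (h : Sim k M s) (v : ℕ) :
    Sim (k + 1) (M.setReg (2 * k) v) (s.setReg k v) :=
  ⟨h.arr, fun y hy => by
    by_cases hk : y = k
    · simp [hk]
    · simp [hk, h.reg y (by omega)]⟩

theorem Sim.unbind {k : ℕ} {M s : Store} {v : ℕ} (h : Sim (k + 1) M (s.setReg k v)) :
    Sim k M s :=
  ⟨h.arr, fun y hy => by
    have := h.reg y (by omega)
    rwa [Store.setReg_reg, if_neg (by omega)] at this⟩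

/-- A loop that counts the register `c` up to the value `N` of the register `b`. -/
theorem run_count_loop {b c N T : ℕ} {p : Prog} (I : ℕ → Store → Prop)
    (hb : ∀ i M, I i M → M.reg b = N) (hc : ∀ i M, I i M → M.reg c = i)
    (step : ∀ i < N, ∀ M, I i M → ∃ t M', Run p M t M' ∧ I (i + 1) M' ∧ t ≤ T)
    {M : Store} (h0 : I 0 M) :
    ∃ t M', Run (.loop (.sub (.reg b) (.reg c)) p) M t M' ∧ I N M' ∧ t ≤ N * (T + 4) + 4 := by
  suffices H : ∀ r i, i + r = N → ∀ M, I i M → ∃ t M',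
      Run (.loop (.sub (.reg b) (.reg c)) p) M t M' ∧ I N M' ∧ t ≤ r * (T + 4) + 4 from
    H N 0 (by simp) M h0
  intro r
  induction r with
  | zero =>
    intro i hi M hM
    obtain rfl : i = N := by simpa using hi
    refine ⟨_, M, Run.loop_false ?_, hM, ?_⟩
    · simp [RExpr.eval, hb _ _ hM, hc _ _ hM]
    · simp [RExpr.cost]
  | succ r ih =>
    intro i hi M hM
    obtain ⟨t, M', h, hI, ht⟩ := step i (by omega) M hM
    obtain ⟨t', M'', h', hI', ht'⟩ := ih (i + 1) (by omega) M' hI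
    refine ⟨_, M'', Run.loop_true ?_ h h', hI', ?_⟩
    · simp only [RExpr.eval, hb _ _ hM, hc _ _ hM]
      omega
    · simp only [RExpr.cost]
      rw [Nat.succ_mul]
      omega

/-- Variables live in even registers and temporaries in odd ones, so the code of a subterm started
at a higher `j` preserves the values already computed. The variable bound by a sum is the first one
outside the simulated range, so overwriting its register does no harm. -/
theorem Tm.run_code (n W : ℕ) (e : Tm) : ∀ {k j : ℕ} {M s : Store}, e.inScope k → Sim k M s →
    e.Fits n W s → ∃ t M', Run (e.code j) M t M' ∧ Sim k M' s ∧ M'.reg (2 * j + 1) = e.eval s ∧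
      (∀ i < j, M'.reg (2 * i + 1) = M.reg (2 * i + 1)) ∧ t ≤ e.bound n W := by
  induction e with
  | const c =>
    intro k j M s _ hM _
    exact ⟨_, _, Run.set _ _ _, hM.setReg_odd _ _, by simp [RExpr.eval, Tm.eval],
      fun i hi => by rw [Store.setReg_reg, if_neg (by omega)], by simp [RExpr.cost, Tm.bound]⟩
  | var x =>
    intro k j M s hx hM _
    refine ⟨_, _, Run.set _ _ _, hM.setReg_odd _ _, ?_,
      fun i hi => by rw [Store.setReg_reg, if_neg (by omega)], by simp [RExpr.cost, Tm.bound]⟩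
    simp only [Tm.inScope, decide_eq_true_eq] at hx
    simp [RExpr.eval, Tm.eval, hM.reg x hx]
  | get a e ih =>
    intro k j M s he hM hf
    obtain ⟨t, M', h, hM', hv, hi, ht⟩ := ih (j := j) he hM hf
    refine ⟨_, _, h.seq (Run.set _ _ _), hM'.setReg_odd _ _, ?_, fun i hij => ?_, ?_⟩
    · simp [RExpr.eval, Tm.eval, hv, hM'.arr]
    · rw [Store.setReg_reg, if_neg (by omega), hi i hij]
    · simp only [RExpr.cost, Tm.bound]
      omega
  | add e f ihe ihf =>
    intro k j M s he hM hf
    simp only [Tm.inScope, Bool.and_eq_true] at he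
    obtain ⟨t, M', h, hM', hv, hi, ht⟩ := ihe (j := j) he.1 hM hf.1
    obtain ⟨t', M'', h', hM'', hv', hi', ht'⟩ := ihf (j := j + 1) he.2 hM' hf.2
    refine ⟨_, _, h.seq (h'.seq (Run.set _ _ _)), hM''.setReg_odd _ _, ?_, fun i hij => ?_, ?_⟩
    · simp only [RExpr.eval, Tm.eval, Store.setReg_reg, if_true]
      rw [hv', hi' j (by omega), hv]
    · rw [Store.setReg_reg, if_neg (by omega), hi' i (by omega), hi i hij]
    · simp only [RExpr.cost, Tm.bound]
      omega
  | sub e f ihe ihf =>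
    intro k j M s he hM hf
    simp only [Tm.inScope, Bool.and_eq_true] at he
    obtain ⟨t, M', h, hM', hv, hi, ht⟩ := ihe (j := j) he.1 hM hf.1
    obtain ⟨t', M'', h', hM'', hv', hi', ht'⟩ := ihf (j := j + 1) he.2 hM' hf.2
    refine ⟨_, _, h.seq (h'.seq (Run.set _ _ _)), hM''.setReg_odd _ _, ?_, fun i hij => ?_, ?_⟩
    · simp only [RExpr.eval, Tm.eval, Store.setReg_reg, if_true]
      rw [hv', hi' j (by omega), hv]
    · rw [Store.setReg_reg, if_neg (by omega), hi' i (by omega), hi i hij]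
    · simp only [RExpr.cost, Tm.bound]
      omega
  | sum b x e f ihe ihf =>
    intro k j M s he hM hf
    simp only [Tm.inScope, Bool.and_eq_true, decide_eq_true_eq] at he
    obtain ⟨⟨rfl, he⟩, hsf⟩ := he
    obtain ⟨hfe, hN, hff⟩ := hf
    obtain ⟨t, M', h, hM', hv, hi, ht⟩ := ihe (j := j) he hM hfe
    -- The three temporaries hold the number of summands, the counter and the partial sum.
    let I : ℕ → Store → Prop := fun i A => Sim x A s ∧ A.reg (2 * j + 1) = e.eval s ∧
      A.reg (2 * (j + 1) + 1) = i ∧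
      A.reg (2 * (j + 2) + 1) = ∑ i ∈ Finset.range i, f.eval (s.setReg x i) ∧
      ∀ i < j, A.reg (2 * i + 1) = M.reg (2 * i + 1)
    obtain ⟨t', M'', h', hI, ht'⟩ := run_count_loop (b := 2 * j + 1) (c := 2 * (j + 1) + 1)
      (N := e.eval s) (T := f.bound n W + 10) (p := (.seq (.set (2 * x) (.reg (2 * (j + 1) + 1)))
        (.seq (f.code (j + 3))
        (.seq (.set (2 * (j + 2) + 1) (.add (.reg (2 * (j + 2) + 1)) (.reg (2 * (j + 3) + 1))))
          (.set (2 * (j + 1) + 1) (.add (.reg (2 * (j + 1) + 1)) (.const 1))))))) I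
      (fun i A hA => hA.2.1) (fun i A hA => hA.2.2.1)
      (by
        rintro i hiN A ⟨hA, hAj, hAc, hAs, hAi⟩
        have hA' := hA.bind i
        obtain ⟨t, A', h, hA', hv, hi, ht⟩ := ihf (j := j + 3) hsf hA' (hff i hiN)
        refine ⟨_, _, (Run.set _ _ _).seq ((by simpa [RExpr.eval, hAc] using h :
          Run _ _ t A').seq ((Run.set _ _ _).seq (Run.set _ _ _))),
          ⟨((hA'.setReg_odd _ _).setReg_odd _ _).unbind, ?_, ?_, ?_, fun i hij => ?_⟩, ?_⟩
        · rw [Store.setReg_reg, if_neg (by omega), Store.setReg_reg, if_neg (by omega),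
            hi j (by omega), Store.setReg_reg, if_neg (by omega), hAj]
        · simp only [RExpr.eval, Store.setReg_reg, if_true]
          rw [if_neg (by omega), hi (j + 1) (by omega), Store.setReg_reg, if_neg (by omega), hAc]
        · simp only [RExpr.eval]
          rw [Store.setReg_reg, if_neg (by omega), Store.setReg_reg, if_pos rfl, hv,
            hi (j + 2) (by omega), Store.setReg_reg, if_neg (by omega), hAs,
            Finset.sum_range_succ]
        · rw [Store.setReg_reg, if_neg (by omega), Store.setReg_reg, if_neg (by omega),
            hi i (by omega), Store.setReg_reg, if_neg (by omega), hAi i hij]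
        · simp only [RExpr.cost]
          omega)
      (M := (M'.setReg (2 * (j + 1) + 1) 0).setReg (2 * (j + 2) + 1) 0)
      ⟨(hM'.setReg_odd _ _).setReg_odd _ _, by simp [hv], by simp, by simp,
        fun i hij => by
          rw [Store.setReg_reg, if_neg (by omega), Store.setReg_reg, if_neg (by omega), hi i hij]⟩
    refine ⟨_, _, h.seq ((Run.set _ _ _).seq ((Run.set _ _ _).seq (h'.seq (Run.set _ _ _)))),
      hI.1.setReg_odd _ _, ?_, fun i hij => ?_, ?_⟩
    · simp [RExpr.eval, hI.2.2.2.1, Tm.eval]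
    · rw [Store.setReg_reg, if_neg (by omega), hI.2.2.2.2 i hij]
    · simp only [RExpr.cost, Tm.bound]
      have := Nat.mul_le_mul_right (f.bound n W + 10 + 4) hN
      rw [show f.bound n W + 14 = f.bound n W + 10 + 4 from rfl]
      omega

/-- The number of rounds and the counter are kept in temporaries, and the loop variable only
receives a copy. The body may therefore overwrite that variable without changing the number of
rounds. -/
theorem Cmd.run_code (n W : ℕ) (p : Cmd) : ∀ {k j : ℕ} {M s : Store}, p.inScope k → Sim k M s →
    p.Fits n W s → ∃ t M', Run (p.code j) M t M' ∧ Sim k M' (p.exec s) ∧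
      (∀ i < j, M'.reg (2 * i + 1) = M.reg (2 * i + 1)) ∧ t ≤ p.bound n W := by
  induction p with
  | set x e =>
    intro k j M s he hM hf
    simp only [Cmd.inScope, Bool.and_eq_true] at he
    obtain ⟨t, M', h, hM', hv, hi, ht⟩ := e.run_code n W (j := j) he.2 hM hf
    refine ⟨_, _, h.seq (Run.set _ _ _), ?_, fun i hij => ?_, ?_⟩
    · simpa [RExpr.eval, Cmd.exec, hv] using hM'.setReg_even x (e.eval s)
    · rw [Store.setReg_reg, if_neg (by omega), hi i hij]
    · simp only [RExpr.cost, Cmd.bound]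
      omega
  | put a i e =>
    intro k j M s he hM hf
    simp only [Cmd.inScope, Bool.and_eq_true] at he
    obtain ⟨t, M', h, hM', hv, hi, ht⟩ := i.run_code n W (j := j) he.1 hM hf.1
    obtain ⟨t', M'', h', hM'', hv', hi', ht'⟩ := e.run_code n W (j := j + 1) he.2 hM' hf.2
    refine ⟨_, _, h.seq (h'.seq (Run.put _ _ _ _)), ⟨?_, ?_⟩, fun l hlj => ?_, ?_⟩
    · simp only [RExpr.eval, Cmd.exec, hv', hi' j (by omega), hv, Store.setArr, hM''.arr]
    · intro x hx
      exact hM''.reg x hx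
    · rw [Store.setArr_reg, hi' l (by omega), hi l hlj]
    · simp only [RExpr.cost, Cmd.bound]
      omega
  | seq p q ihp ihq =>
    intro k j M s he hM hf
    simp only [Cmd.inScope, Bool.and_eq_true] at he
    obtain ⟨t, M', h, hM', hi, ht⟩ := ihp (j := j) he.1 hM hf.1
    obtain ⟨t', M'', h', hM'', hi', ht'⟩ := ihq (j := j) he.2 hM' hf.2
    exact ⟨_, _, h.seq h', hM'', fun i hij => by rw [hi' i hij, hi i hij],
      by simp only [Cmd.bound]; omega⟩
  | loop b x e p ih =>
    intro k j M s he hM hf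
    simp only [Cmd.inScope, Bool.and_eq_true, decide_eq_true_eq] at he
    obtain ⟨⟨hx, he⟩, hp⟩ := he
    obtain ⟨hfe, hN, hff⟩ := hf
    obtain ⟨t, M', h, hM', hv, hi, ht⟩ := e.run_code n W (j := j) he hM hfe
    let I : ℕ → Store → Prop := fun i A => Sim k A (s.rounds p.exec x i) ∧
      A.reg (2 * j + 1) = e.eval s ∧ A.reg (2 * (j + 1) + 1) = i ∧
      ∀ i < j, A.reg (2 * i + 1) = M.reg (2 * i + 1)
    obtain ⟨t', M'', h', hI, ht'⟩ := run_count_loop (b := 2 * j + 1) (c := 2 * (j + 1) + 1)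
      (N := e.eval s) (T := p.bound n W + 6) (p := (.seq (.set (2 * x) (.reg (2 * (j + 1) + 1)))
        (.seq (p.code (j + 2))
          (.set (2 * (j + 1) + 1) (.add (.reg (2 * (j + 1) + 1)) (.const 1)))))) I
      (fun i A hA => hA.2.1) (fun i A hA => hA.2.2.1)
      (by
        rintro i hiN A ⟨hA, hAj, hAc, hAi⟩
        obtain ⟨t, A', h, hA', hi, ht⟩ := ih (j := j + 2) hp (hA.setReg_even x i) (hff i hiN)
        refine ⟨_, _, (Run.set _ _ _).seq ((by simpa [RExpr.eval, hAc] using h :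
          Run _ _ t A').seq (Run.set _ _ _)),
          ⟨hA'.setReg_odd _ _, ?_, ?_, fun i hij => ?_⟩, ?_⟩
        · rw [Store.setReg_reg, if_neg (by omega),
            hi j (by omega), Store.setReg_reg, if_neg (by omega), hAj]
        · simp only [RExpr.eval, Store.setReg_reg, if_true]
          rw [hi (j + 1) (by omega), Store.setReg_reg, if_neg (by omega), hAc]
        · rw [Store.setReg_reg, if_neg (by omega),
            hi i (by omega), Store.setReg_reg, if_neg (by omega), hAi i hij]
        · simp only [RExpr.cost]
          omega)
      (M := M'.setReg (2 * (j + 1) + 1) 0)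
      ⟨hM'.setReg_odd _ _, by simp [hv], by simp,
        fun i hij => by rw [Store.setReg_reg, if_neg (by omega), hi i hij]⟩
    refine ⟨_, _, h.seq ((Run.set _ _ _).seq h'), hI.1, hI.2.2.2, ?_⟩
    simp only [RExpr.cost, Cmd.bound]
    have := Nat.mul_le_mul_right (p.bound n W + 6 + 4) hN
    rw [show p.bound n W + 10 = p.bound n W + 6 + 4 from rfl]
    omega

/-! ### The order of growth of the running time -/

namespace Tm

/-- The coefficient in the polynomial bound on the running time. -/
def coef : Tm → ℕ
  | const _ => 2
  | var _ => 2
  | get _ e => e.coef + 3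
  | add e f => e.coef + f.coef + 4
  | sub e f => e.coef + f.coef + 4
  | sum _ _ e f => e.coef + 10 + (f.coef + 14)

/-- The nesting depth of the sums with flag `b`. -/
def deg (b : Bool) : Tm → ℕ
  | const _ => 0
  | var _ => 0
  | get _ e => e.deg b
  | add e f => max (e.deg b) (f.deg b)
  | sub e f => max (e.deg b) (f.deg b)
  | sum b' _ e f => max (e.deg b) (f.deg b + if b' = b then 1 else 0)

end Tm

namespace Cmd

/-- The coefficient in the polynomial bound on the running time. -/
def coef : Cmd → ℕ
  | set _ e => e.coef + 2
  | put _ i e => i.coef + e.coef + 3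
  | seq p q => p.coef + q.coef
  | loop _ _ e p => e.coef + 6 + (p.coef + 10)

/-- The nesting depth of the loops and sums with flag `b`. -/
def deg (b : Bool) : Cmd → ℕ
  | set _ e => e.deg b
  | put _ i e => max (i.deg b) (e.deg b)
  | seq p q => max (p.deg b) (q.deg b)
  | loop b' _ e p => max (e.deg b) (p.deg b + if b' = b then 1 else 0)

end Cmd

theorem monomial_mono {n W a b a' b' : ℕ} (hn : 0 < n) (hW : 0 < W) (ha : a ≤ a') (hb : b ≤ b') :
    n ^ a * W ^ b ≤ n ^ a' * W ^ b' :=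
  Nat.mul_le_mul (Nat.pow_le_pow_right hn ha) (Nat.pow_le_pow_right hW hb)

theorem monomial_add {n W a b a₁ b₁ a₂ b₂ x y c d r : ℕ} (hn : 0 < n) (hW : 0 < W)
    (hx : x ≤ c * (n ^ a₁ * W ^ b₁)) (hy : y ≤ d * (n ^ a₂ * W ^ b₂))
    (ha₁ : a₁ ≤ a) (hb₁ : b₁ ≤ b) (ha₂ : a₂ ≤ a) (hb₂ : b₂ ≤ b) :
    x + y + r ≤ (c + d + r) * (n ^ a * W ^ b) := by
  have h₁ := hx.trans (Nat.mul_le_mul_left c (monomial_mono hn hW ha₁ hb₁))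
  have h₂ := hy.trans (Nat.mul_le_mul_left d (monomial_mono hn hW ha₂ hb₂))
  have h₃ : r * 1 ≤ r * (n ^ a * W ^ b) := Nat.mul_le_mul_left r (Nat.succ_le_of_lt (by positivity))
  rw [add_mul, add_mul]
  omega

theorem monomial_loop {n W a b x c r : ℕ} (f : Bool) (hn : 0 < n) (hW : 0 < W)
    (hx : x ≤ c * (n ^ a * W ^ b)) :
    cond f n W * (x + r) ≤ (c + r) *
      (n ^ (a + if f = true then 1 else 0) * W ^ (b + if f = false then 1 else 0)) := by
  have h : x + r ≤ (c + r) * (n ^ a * W ^ b) := by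
    have h₃ : r * 1 ≤ r * (n ^ a * W ^ b) := Nat.mul_le_mul_left r (Nat.succ_le_of_lt (by positivity))
    rw [add_mul]
    omega
  refine (Nat.mul_le_mul_left _ h).trans (le_of_eq ?_)
  cases f <;> simp <;> ring

/-- Reduces the running time to syntax: the exponents are nesting depths, which can be computed by
`decide` for a concrete term. -/
theorem Tm.bound_le {n W : ℕ} (hn : 0 < n) (hW : 0 < W) (e : Tm) :
    e.bound n W ≤ e.coef * (n ^ e.deg true * W ^ e.deg false) := by
  induction e with
  | const c => simp [bound, coef, deg]
  | var x => simp [bound, coef, deg]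
  | get a e ih =>
    exact monomial_add (y := 0) (d := 0) (r := 3) hn hW ih (by simp) le_rfl le_rfl le_rfl le_rfl
  | add e f ihe ihf =>
    exact monomial_add hn hW ihe ihf (le_max_left _ _) (le_max_left _ _) (le_max_right _ _)
      (le_max_right _ _)
  | sub e f ihe ihf =>
    exact monomial_add hn hW ihe ihf (le_max_left _ _) (le_max_left _ _) (le_max_right _ _)
      (le_max_right _ _)
  | sum b x e f ihe ihf =>
    have := monomial_add (r := 10) hn hW ihe (monomial_loop (r := 14) b hn hW ihf)
      (le_max_left _ _) (le_max_left _ _) (le_max_right _ _) (le_max_right _ _)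
    simp only [bound, coef, deg]
    convert this using 1 <;> ring

theorem Cmd.bound_le {n W : ℕ} (hn : 0 < n) (hW : 0 < W) (p : Cmd) :
    p.bound n W ≤ p.coef * (n ^ p.deg true * W ^ p.deg false) := by
  induction p with
  | set x e =>
    exact monomial_add (y := 0) (d := 0) (r := 2) hn hW (e.bound_le hn hW) (by simp)
      le_rfl le_rfl le_rfl le_rfl
  | put a i e =>
    exact monomial_add hn hW (i.bound_le hn hW) (e.bound_le hn hW) (le_max_left _ _)
      (le_max_left _ _) (le_max_right _ _) (le_max_right _ _)
  | seq p q ihp ihq =>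
    exact monomial_add (r := 0) hn hW ihp ihq (le_max_left _ _) (le_max_left _ _)
      (le_max_right _ _) (le_max_right _ _)
  | loop b x e p ih =>
    have := monomial_add (r := 6) hn hW (e.bound_le hn hW) (monomial_loop (r := 10) b hn hW ih)
      (le_max_left _ _) (le_max_left _ _) (le_max_right _ _) (le_max_right _ _)
    simp only [bound, coef, deg]
    convert this using 1 <;> ring

/-! ### Total correctness of commands -/

/-- Started in `s`, the command keeps to the promised numbers of rounds and achieves `Q`. -/
def Cmd.Ok (n W : ℕ) (p : Cmd) (s : Store) (Q : Store → Prop) : Prop :=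
  p.Fits n W s ∧ Q (p.exec s)

namespace Cmd

theorem Ok.mono {n W : ℕ} {p : Cmd} {s : Store} {Q R : Store → Prop} (h : p.Ok n W s Q)
    (hQ : ∀ s', Q s' → R s') : p.Ok n W s R :=
  ⟨h.1, hQ _ h.2⟩

theorem Ok.seq {n W : ℕ} {p q : Cmd} {s : Store} {Q : Store → Prop}
    (h : p.Ok n W s fun s' => q.Ok n W s' Q) : (Cmd.seq p q).Ok n W s Q :=
  ⟨⟨h.1, h.2.1⟩, h.2.2⟩

theorem Ok.set {n W x : ℕ} {e : Tm} {s : Store} {Q : Store → Prop} (he : e.Fits n W s)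
    (h : Q (s.setReg x (e.eval s))) : (Cmd.set x e).Ok n W s Q :=
  ⟨he, h⟩

theorem Ok.put {n W a : ℕ} {i e : Tm} {s : Store} {Q : Store → Prop} (hi : i.Fits n W s)
    (he : e.Fits n W s) (h : Q (s.setArr a (i.eval s) (e.eval s))) : (Cmd.put a i e).Ok n W s Q :=
  ⟨⟨hi, he⟩, h⟩

theorem Ok.loop {n W x : ℕ} {b : Bool} {e : Tm} {p : Cmd} {s : Store} {Q : Store → Prop}
    (I : ℕ → Store → Prop) (he : e.Fits n W s) (hN : e.eval s ≤ cond b n W) (h0 : I 0 s)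
    (step : ∀ i < e.eval s, ∀ s', I i s' → p.Ok n W (s'.setReg x i) (I (i + 1)))
    (hQ : ∀ s', I (e.eval s) s' → Q s') : (Cmd.loop b x e p).Ok n W s Q := by
  have key : ∀ i ≤ e.eval s, I i (s.rounds p.exec x i) := by
    intro i
    induction i with
    | zero => exact fun _ => h0
    | succ i ih => exact fun hi => (step i hi _ (ih (by omega))).2
  exact ⟨⟨he, hN, fun i hi => (step i hi _ (key i hi.le)).1⟩, hQ _ (key _ le_rfl)⟩

end Cmd

/-! ### Box representations by inequalities -/

/-- Two nonempty intervals meet iff each starts before the other ends. Admitting `u = v` makes the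
diagonal express nonemptiness, so no separate condition has to be tested later. -/
theorem isBoxRep_iff {V : Type*} (G : SimpleGraph V) (d : ℕ) (l r : Fin d → V → ℝ) :
    IsBoxRep G d l r ↔
      ∀ u v, (u = v ∨ G.Adj u v) ↔ ∀ i, l i u ≤ r i v ∧ l i v ≤ r i u := by
  have hI : ∀ i u v, (∀ w, l i w ≤ r i w) → u ≠ v →
      ((intervalGraph (l i) (r i)).Adj u v ↔ l i u ≤ r i v ∧ l i v ≤ r i u) := by
    intro i u v h huv
    simp only [intervalGraph, ne_eq, huv, not_false_eq_true, true_and, Set.Icc_inter_Icc,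
      Set.nonempty_Icc, max_le_iff, le_min_iff]
    have := h u
    have := h v
    tauto
  constructor
  · rintro ⟨hle, hG⟩ u v
    by_cases huv : u = v
    · subst huv
      simp [hle]
    · rw [hG, SimpleGraph.iInf_adj]
      simp only [huv, false_or, ne_eq, not_false_eq_true, and_true]
      exact forall_congr' fun i => hI i u v (hle i) huv
  · intro h
    have hle : ∀ i v, l i v ≤ r i v := fun i v => (((h v v).1 (Or.inl rfl)) i).1
    refine ⟨hle, ?_⟩
    ext u v
    by_cases huv : u = v
    · subst huv
      simp
    · rw [SimpleGraph.iInf_adj]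
      have := h u v
      simp only [huv, false_or] at this
      rw [this]
      simp only [ne_eq, huv, not_false_eq_true, and_true]
      exact forall_congr' fun i => (hI i u v (hle i) huv).symm

theorem isBoxRep_natCast_iff {V : Type*} (G : SimpleGraph V) (d : ℕ) (l r : Fin d → V → ℕ) :
    IsBoxRep G d (fun i v => (l i v : ℝ)) (fun i v => (r i v : ℝ)) ↔
      ∀ u v, (u = v ∨ G.Adj u v) ↔ ∀ i, l i u ≤ r i v ∧ l i v ≤ r i u := by
  rw [isBoxRep_iff]
  simp only [Nat.cast_le]

/-- If the vertices outside `A` form a clique, then `G` has a box representation with one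
dimension for each vertex of `A`. -/
theorem exists_isBoxRep_card {V : Type*} (G : SimpleGraph V) (A : Finset V)
    (hA : ∀ u v, u ∉ A → v ∉ A → u ≠ v → G.Adj u v) :
    ∃ l r : Fin A.card → V → ℝ, IsBoxRep G A.card l r := by
  classical
  let e := A.equivFin.symm
  -- In dimension `i` the vertex `e i` gets `[0, 0]`, its neighbours `[0, 1]` and all others `[1,
  -- 1]`; only `e i` and its non-neighbours are separated.
  refine ⟨fun i v => if v = e i ∨ G.Adj (e i) v then 0 else 1,
    fun i v => if v = e i then 0 else 1, ?_⟩
  rw [isBoxRep_iff]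
  intro u v
  constructor
  · rintro (rfl | h) i
    · refine ⟨?_, ?_⟩ <;> split_ifs <;> simp_all
    · refine ⟨?_, ?_⟩ <;> split_ifs <;> simp_all [G.adj_comm]
  · intro h
    by_contra! hn
    have hor : u ∈ A ∨ v ∈ A := by
      by_contra! hc
      exact hn.2 (hA u v hc.1 hc.2 hn.1)
    rcases hor with hu | hv
    · have := (h (A.equivFin ⟨u, hu⟩)).2
      simp [e, hn.1.symm, hn.2] at this
      norm_num at this
    · have := (h (A.equivFin ⟨v, hv⟩)).1
      simp [e, hn.1, G.adj_comm v u, hn.2] at this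
      norm_num at this

theorem boxicity_le {V : Type*} [Fintype V] (G : SimpleGraph V) (k : ℕ) (S : Finset V)
    (hS : G.IsClique (S : Set V)) (hk : Fintype.card V ≤ S.card + k) : boxicity G ≤ k := by
  classical
  have h := exists_isBoxRep_card G Sᶜ fun u v hu hv huv => hS (by simpa using hu)
    (by simpa using hv) huv
  have h₁ : boxicity G ≤ (Sᶜ.card : ℕ) := sInf_le ⟨_, rfl, h⟩
  refine h₁.trans ?_
  rw [Finset.card_compl]
  exact_mod_cast (by omega)

theorem boxicity_eq {V : Type*} {G : SimpleGraph V} {d : ℕ}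
    (h : ∃ l r : Fin d → V → ℝ, IsBoxRep G d l r)
    (hlt : ∀ d' < d, ¬ ∃ l r : Fin d' → V → ℝ, IsBoxRep G d' l r) : boxicity G = d := by
  apply le_antisymm
  · exact sInf_le ⟨d, rfl, h⟩
  · refine le_sInf ?_
    rintro _ ⟨m, rfl, hm⟩
    by_contra! hc
    exact hlt m (by exact_mod_cast hc) hm

/-! ### Integral box representations extended from a small vertex set -/

/-- The intervals `[L i v, R i v]` are given by `a` and `b` for `v ∈ A`, and for all other `v` they
are the least intervals that contain `q` and meet the intervals of the neighbours of `v` in `A`.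
The right end points are cut off at `B`. -/
structure IsExtension {V : Type*} (G : SimpleGraph V) (A : Finset V) (d q B : ℕ)
    (a b L R : Fin d → V → ℕ) : Prop where
  left_mem : ∀ i, ∀ v ∈ A, L i v = a i v
  right_mem : ∀ i, ∀ v ∈ A, R i v = b i v
  left : ∀ i, ∀ v ∉ A, ∀ t, t < L i v ↔ t < q ∧ ∀ w ∈ A, G.Adj v w → t < b i w
  right : ∀ i, ∀ v ∉ A, ∀ t, t < R i v ↔ t < B ∧ (t < q ∨ ∃ w ∈ A, G.Adj v w ∧ t < a i w)

/-- A monotone map to the integers between `0` and `4 m` that maps `p` to `2 m` and is strict at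
`2 m` further points. -/
theorem exists_compression (E : Finset ℝ) (p : ℝ) (m : ℕ) (hE : E.card ≤ 2 * m) :
    ∃ φ : ℝ → ℕ, φ p = 2 * m ∧ ∀ x ∈ insert p E, φ x ≤ 4 * m ∧
      ∀ y ∈ insert p E, (x ≤ y ↔ φ x ≤ φ y) := by
  classical
  let F := insert p E
  let ψ : ℝ → ℕ := fun x => (F.filter (· < x)).card
  have hF : F.card ≤ 2 * m + 1 := (Finset.card_insert_le _ _).trans (by omega)
  have hψ : ∀ x ∈ F, ψ x ≤ 2 * m := by
    intro x hx
    have : ψ x < F.card := Finset.card_lt_card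
      (Finset.filter_ssubset.2 ⟨x, hx, lt_irrefl x⟩)
    omega
  have hmono : ∀ x y, x ≤ y → ψ x ≤ ψ y := fun x y hxy =>
    Finset.card_le_card (Finset.monotone_filter_right _ fun z _ hz => lt_of_lt_of_le hz hxy)
  have hstrict : ∀ x ∈ F, ∀ y, x < y → ψ x < ψ y := by
    intro x hx y hxy
    refine Finset.card_lt_card ⟨Finset.monotone_filter_right _ fun z _ hz => lt_trans hz hxy, ?_⟩
    intro hsub
    have := hsub (Finset.mem_filter.2 ⟨hx, hxy⟩)
    simp at this
  have hp : ψ p ≤ 2 * m := hψ p (Finset.mem_insert_self _ _)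
  -- Counting the points of `F` below `x` gives values up to `2 * m`; a shift by at most `2 * m`
  -- then brings `p` to `2 * m`.
  refine ⟨fun x => ψ x + (2 * m - ψ p), by dsimp only; omega, fun x hx => ⟨?_, fun y hy => ⟨?_, ?_⟩⟩⟩
  · have := hψ x hx
    dsimp only
    omega
  · intro hxy
    have := hmono x y hxy
    dsimp only
    omega
  · intro h
    by_contra! hc
    have := hstrict y hy x hc
    dsimp only at h
    omega

/-- Intervals that meet pairwise have a common point. -/
theorem exists_common_point {V : Type*} [Finite V] (A : Finset V) (l r : V → ℝ)
    (h : ∀ u v, u ∉ A → v ∉ A → l u ≤ r v) : ∃ p, ∀ v, v ∉ A → l v ≤ p ∧ p ≤ r v := by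
  classical
  cases nonempty_fintype V
  by_cases hne : (Aᶜ).Nonempty
  -- The largest left end point belongs to all the intervals.
  · obtain ⟨w, hw, hmax⟩ := Finset.exists_max_image Aᶜ l hne
    exact ⟨l w, fun v hv => ⟨hmax v (by simpa using hv), h w v (by simpa using hw) hv⟩⟩
  · refine ⟨0, fun v hv => (hne ⟨v, by simpa using hv⟩).elim⟩

/-- If the vertices outside `A` form a clique, then a box representation of `G` can be replaced by
one that extends small integral intervals for the vertices of `A`. -/
theorem exists_integral {V : Type*} [Finite V] (G : SimpleGraph V) (A : Finset V)
    (hA : ∀ u v, u ∉ A → v ∉ A → u ≠ v → G.Adj u v) {d : ℕ}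
    (hd : ∃ l r : Fin d → V → ℝ, IsBoxRep G d l r) :
    ∃ a b : Fin d → V → ℕ, (∀ i, ∀ v ∈ A, a i v ≤ 4 * A.card ∧ b i v ≤ 4 * A.card) ∧
      ∀ L R : Fin d → V → ℕ, IsExtension G A d (2 * A.card) (4 * A.card + 1) a b L R →
        ∀ u v, (u = v ∨ G.Adj u v) ↔ ∀ i, L i u ≤ R i v ∧ L i v ≤ R i u := by
  classical
  obtain ⟨l, r, hlr⟩ := hd
  rw [isBoxRep_iff] at hlr
  have hle : ∀ i v, l i v ≤ r i v := fun i v => ((hlr v v).1 (Or.inl rfl) i).1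
  have hadj : ∀ i u v, G.Adj u v → l i u ≤ r i v := fun i u v h => ((hlr u v).1 (Or.inr h) i).1
  have hp : ∀ i, ∃ p, ∀ v, v ∉ A → l i v ≤ p ∧ p ≤ r i v := by
    refine fun i => exists_common_point A _ _ fun u v hu hv => ?_
    by_cases huv : u = v
    · exact huv ▸ hle i u
    · exact hadj i u v (hA u v hu hv huv)
  choose p hp using hp
  have hφ := fun i => exists_compression (A.image (l i) ∪ A.image (r i)) (p i) A.card (by
    have h₁ := Finset.card_union_le (A.image (l i)) (A.image (r i))
    have h₂ := Finset.card_image_le (s := A) (f := l i)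
    have h₃ := Finset.card_image_le (s := A) (f := r i)
    omega)
  choose φ hφp hφ using hφ
  have hlm : ∀ i, ∀ v ∈ A, l i v ∈ insert (p i) (A.image (l i) ∪ A.image (r i)) := fun i v hv =>
    Finset.mem_insert_of_mem (Finset.mem_union_left _ (Finset.mem_image_of_mem _ hv))
  have hrm : ∀ i, ∀ v ∈ A, r i v ∈ insert (p i) (A.image (l i) ∪ A.image (r i)) := fun i v hv =>
    Finset.mem_insert_of_mem (Finset.mem_union_right _ (Finset.mem_image_of_mem _ hv))
  have hpm : ∀ i, p i ∈ insert (p i) (A.image (l i) ∪ A.image (r i)) := fun i =>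
    Finset.mem_insert_self _ _
  have hlt : ∀ i, ∀ x ∈ insert (p i) (A.image (l i) ∪ A.image (r i)),
      ∀ y ∈ insert (p i) (A.image (l i) ∪ A.image (r i)), x < y → φ i x < φ i y := by
    intro i x hx y hy hxy
    by_contra! hc
    exact absurd (((hφ i y hy).2 x hx).2 hc) (not_le.2 hxy)
  refine ⟨fun i v => φ i (l i v), fun i v => φ i (r i v), fun i v hv =>
    ⟨(hφ i _ (hlm i v hv)).1, (hφ i _ (hrm i v hv)).1⟩, fun L R hLR => ?_⟩
  -- All extended intervals outside `A` contain `2 * A.card`, the image of `p i`, hence meet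
  -- pairwise.
  have hL2 : ∀ i v, v ∉ A → L i v ≤ 2 * A.card := by
    intro i v hv
    by_contra! hc
    exact absurd ((hLR.left i v hv _).1 hc).1 (lt_irrefl _)
  have hR2 : ∀ i v, v ∉ A → 2 * A.card ≤ R i v := by
    intro i v hv
    by_contra! hc
    exact absurd ((hLR.right i v hv _).2 ⟨by omega, Or.inl hc⟩) (lt_irrefl _)
  -- Neighbours meet by construction of the extension. For non-neighbours, some dimension separates
  -- the original intervals; the original interval of `v` contains `p i` and meets those of all its
  -- neighbours, so the least such interval stays on the same side of that of `u`.
  have mixed : ∀ u v, u ∈ A → v ∉ A →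
      (G.Adj u v ↔ ∀ i, L i u ≤ R i v ∧ L i v ≤ R i u) := by
    intro u v hu hv
    constructor
    · intro h i
      constructor
      · rw [hLR.left_mem i u hu]
        by_contra! hc
        exact absurd ((hLR.right i v hv _).2 ⟨hc.trans_le (((hφ i _ (hlm i u hu)).1).trans
          (by omega)), Or.inr ⟨u, hu, h.symm, hc⟩⟩) (lt_irrefl _)
      · rw [hLR.right_mem i u hu]
        by_contra! hc
        exact absurd (((hLR.left i v hv _).1 hc).2 u hu h.symm) (lt_irrefl _)
    · intro h
      by_contra hn
      have huv : u ≠ v := fun h => hv (h ▸ hu)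
      have : ¬ ∀ i, l i u ≤ r i v ∧ l i v ≤ r i u := by
        rw [← hlr u v]
        tauto
      push Not at this
      obtain ⟨i, hi⟩ := this
      by_cases hc : l i u ≤ r i v
      · have h₁ := hi hc
        refine absurd (h i).2 (not_le.2 ?_)
        rw [hLR.right_mem i u hu, hLR.left i v hv]
        refine ⟨?_, fun w hw hvw => ?_⟩
        · rw [← hφp i]
          exact hlt i _ (hrm i u hu) _ (hpm i) (h₁.trans_le (hp i v hv).1)
        · exact hlt i _ (hrm i u hu) _ (hrm i w hw) (h₁.trans_le (hadj i v w hvw))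
      · have h₁ := not_le.1 hc
        have h₂ := hlt i _ (hpm i) _ (hlm i u hu) ((hp i v hv).2.trans_lt h₁)
        have h₃ := (h i).1
        rw [hLR.left_mem i u hu] at h₃
        -- The threshold form of `right` needs a strict inequality, hence the predecessor; `h₂`
        -- makes `φ i (l i u)` positive.
        obtain ⟨-, h₄ | ⟨w, hw, hvw, h₄⟩⟩ := (hLR.right i v hv (φ i (l i u) - 1)).1
          (by omega)
        · rw [hφp] at h₂
          omega
        · have := hlt i _ (hlm i w hw) _ (hlm i u hu) ((hadj i w v hvw.symm).trans_lt h₁)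
          omega
  intro u v
  by_cases hu : u ∈ A <;> by_cases hv : v ∈ A
  · rw [hlr u v]
    refine forall_congr' fun i => ?_
    rw [hLR.left_mem i u hu, hLR.left_mem i v hv, hLR.right_mem i u hu, hLR.right_mem i v hv,
      (hφ i _ (hlm i u hu)).2 _ (hrm i v hv), (hφ i _ (hlm i v hv)).2 _ (hrm i u hu)]
  · rw [← mixed u v hu hv]
    exact or_iff_right fun h : u = v => hv (h ▸ hu)
  · rw [or_iff_right fun h : u = v => hu (h ▸ hv), G.adj_comm, mixed v u hv hu]
    exact forall_congr' fun i => and_comm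
  · refine iff_of_true ?_ fun i => ⟨(hL2 i u hu).trans (hR2 i v hv), (hL2 i v hv).trans (hR2 i u hu)⟩
    by_cases huv : u = v
    · exact Or.inl huv
    · exact Or.inr (hA u v hu hv huv)

/-! ### Enumeration by digits -/

/-- Expansion in base `B`: every assignment of `N` end points below `B` is reached by a single loop
variable running up to `B ^ N`. -/
theorem exists_digits (B N : ℕ) (f : ℕ → ℕ) (hf : ∀ t, f t < B) :
    ∃ c < B ^ N, ∀ t < N, c / B ^ t % B = f t := by
  let g : Fin N → Fin B := fun t => ⟨f t, hf t⟩
  refine ⟨finFunctionFinEquiv g, (finFunctionFinEquiv g).2, fun t ht => ?_⟩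
  have := congrFun (finFunctionFinEquiv.symm_apply_apply g) ⟨t, ht⟩
  simpa [g, finFunctionFinEquiv, Fin.ext_iff] using congrArg Fin.val this

/-! ### Sums that count -/

theorem sum_range_indicator_lt {N q : ℕ} {f : ℕ → ℕ} (hq : q ≤ N)
    (hf : ∀ j < N, f j = if j < q then 1 else 0) : ∑ j ∈ Finset.range N, f j = q := by
  rw [Finset.sum_congr rfl fun j hj => hf j (Finset.mem_range.1 hj), ← Finset.card_filter]
  have : (Finset.range N).filter (· < q) = Finset.range q := by
    ext j
    simp only [Finset.mem_filter, Finset.mem_range]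
    omega
  rw [this, Finset.card_range]

/-- Division by counting the `j` with `(j + 1) * P ≤ c`; truncated subtraction turns this condition
into its indicator. -/
theorem sum_range_div {c P : ℕ} (hP : 0 < P) :
    ∑ j ∈ Finset.range c, (1 - ((j + 1) * P - c)) = c / P := by
  refine sum_range_indicator_lt (Nat.div_le_self _ _) fun j _ => ?_
  have : j < c / P ↔ (j + 1) * P ≤ c := by
    rw [← Nat.le_div_iff_mul_le hP]
    exact Nat.lt_iff_add_one_le
  split_ifs with h <;> rw [this] at h <;> omega

theorem sum_range_le {N : ℕ} {f : ℕ → ℕ} (hf : ∀ t < N, f t ≤ 1) :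
    ∑ t ∈ Finset.range N, f t ≤ N := by
  simpa using Finset.sum_le_card_nsmul (Finset.range N) f 1 fun t ht => hf t (Finset.mem_range.1 ht)

/-- The `t` satisfying a downward closed condition form an initial segment, and counting them finds
its end. Minima and maxima of end points are computed this way, which is why `IsExtension` is
phrased by thresholds. -/
theorem lt_sum_range_iff {Q : ℕ → Prop} (hQ : ∀ t t', t ≤ t' → Q t' → Q t) {f : ℕ → ℕ} {N : ℕ}
    (h₁ : ∀ t < N, Q t → f t = 1) (h₀ : ∀ t < N, ¬ Q t → f t = 0) (t : ℕ) :
    t < ∑ t ∈ Finset.range N, f t ↔ t < N ∧ Q t := by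
  induction N generalizing t with
  | zero => simp
  | succ N ih =>
    have ih := ih (fun t ht => h₁ t (by omega)) (fun t ht => h₀ t (by omega))
    have hle : ∑ t ∈ Finset.range N, f t ≤ N := sum_range_le fun t ht => by
      by_cases h : Q t
      · exact (h₁ t (by omega) h).le
      · simp [h₀ t (by omega) h]
    rw [Finset.sum_range_succ]
    by_cases hN : Q N
    · have hge : ¬ ∑ t ∈ Finset.range N, f t < N := fun hlt =>
        lt_irrefl _ ((ih _).2 ⟨hlt, hQ _ _ hlt.le hN⟩)
      rw [h₁ N (by omega) hN]
      constructor
      · intro h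
        exact ⟨by omega, hQ t N (by omega) hN⟩
      · intro h
        omega
    · rw [h₀ N (by omega) hN, add_zero, ih]
      constructor
      · exact fun h => ⟨by omega, h.2⟩
      · refine fun h => ⟨?_, h.2⟩
        rcases Nat.lt_succ_iff_lt_or_eq.1 h.1 with h' | h'
        · exact h'
        · exact (hN (h' ▸ h.2)).elim

/-- With `k = n` this computes the size of `A`, with `k` a vertex its rank. -/
theorem sum_range_mem {n : ℕ} (A : Finset (Fin n)) {f : ℕ → ℕ}
    (hf : ∀ v : Fin n, f v = if v ∈ A then 1 else 0) {k : ℕ} (hk : k ≤ n) :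
    ∑ w ∈ Finset.range k, f w = (A.filter fun w : Fin n => (w : ℕ) < k).card := by
  have h₁ : ∑ w ∈ Finset.range k, f w = ∑ w ∈ Finset.range n, if w < k then f w else 0 := by
    rw [← Finset.sum_filter]
    congr 1
    ext w
    simp only [Finset.mem_filter, Finset.mem_range]
    omega
  rw [h₁, ← Fin.sum_univ_eq_sum_range (fun w => if w < k then f w else 0) n, Finset.card_eq_sum_ones,
    Finset.sum_filter, ← Finset.sum_subset (Finset.subset_univ A)]
  · exact Finset.sum_congr rfl fun w hw => by simp [hf, hw]
  · intro w _ hw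
    simp [hf, hw]

/-! ### Candidates -/

/-- The rank of a vertex with respect to a set of vertices. -/
def rank {n : ℕ} (A : Finset (Fin n)) (v : Fin n) : ℕ :=
  (A.filter fun w : Fin n => (w : ℕ) < v).card

theorem rank_le {n : ℕ} (A : Finset (Fin n)) (v : Fin n) : rank A v ≤ A.card :=
  Finset.card_filter_le _ _

theorem rank_lt {n : ℕ} {A : Finset (Fin n)} {v : Fin n} (hv : v ∈ A) : rank A v < A.card :=
  Finset.card_lt_card (Finset.filter_ssubset.2 ⟨v, hv, lt_irrefl _⟩)

theorem rank_lt_rank {n : ℕ} {A : Finset (Fin n)} {u v : Fin n} (hu : u ∈ A) (huv : u < v) :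
    rank A u < rank A v := by
  refine Finset.card_lt_card ⟨Finset.monotone_filter_right _ fun w _ hw => ?_, fun h => ?_⟩
  · exact lt_trans (b := (u : ℕ)) hw huv
  · have := h (Finset.mem_filter.2 ⟨hu, huv⟩)
    simp at this

theorem rank_injOn {n : ℕ} {A : Finset (Fin n)} {u v : Fin n} (hu : u ∈ A) (hv : v ∈ A)
    (h : rank A u = rank A v) : u = v := by
  rcases lt_trichotomy u v with h' | h' | h'
  · exact absurd h (rank_lt_rank hu h').ne
  · exact h'
  · exact absurd h (rank_lt_rank hv h').ne'

/-- The left end points that the candidate `c` gives to the vertices of `A`. -/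
def leftDigit {n : ℕ} (A : Finset (Fin n)) (d c : ℕ) (i : Fin d) (v : Fin n) : ℕ :=
  c / (4 * A.card + 1) ^ (rank A v + i * A.card) % (4 * A.card + 1)

/-- The right end points that the candidate `c` gives to the vertices of `A`. -/
def rightDigit {n : ℕ} (A : Finset (Fin n)) (d c : ℕ) (i : Fin d) (v : Fin n) : ℕ :=
  c / (4 * A.card + 1) ^ (rank A v + i * A.card + d * A.card) % (4 * A.card + 1)

theorem mul_add_inj {m i i' r r' : ℕ} (hr : r < m) (hr' : r' < m) (h : r + i * m = r' + i' * m) :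
    i = i' ∧ r = r' := by
  have hm : 0 < m := by omega
  have h₁ := congrArg (· / m) h
  have h₂ := congrArg (· % m) h
  simp only [Nat.add_mul_div_right _ _ hm, Nat.div_eq_of_lt hr, Nat.div_eq_of_lt hr', zero_add,
    Nat.add_mul_mod_self_right, Nat.mod_eq_of_lt hr, Nat.mod_eq_of_lt hr'] at h₁ h₂
  exact ⟨h₁, h₂⟩

theorem add_mul_lt_mul {m i d r : ℕ} (hr : r < m) (hi : i < d) : r + i * m < d * m := by
  have := Nat.mul_le_mul_right m hi
  rw [Nat.succ_mul] at this
  omega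

/-- Some candidate encodes a box representation, if there is any. -/
theorem exists_candidate {n : ℕ} (G : SimpleGraph (Fin n)) (A : Finset (Fin n))
    (hA : ∀ u v, u ∉ A → v ∉ A → u ≠ v → G.Adj u v) {d : ℕ}
    (hd : ∃ l r : Fin d → Fin n → ℝ, IsBoxRep G d l r) :
    ∃ c < (4 * A.card + 1) ^ (d * (A.card + A.card)), ∀ L R : Fin d → Fin n → ℕ,
      IsExtension G A d (2 * A.card) (4 * A.card + 1) (leftDigit A d c) (rightDigit A d c) L R →
        ∀ u v, (u = v ∨ G.Adj u v) ↔ ∀ i, L i u ≤ R i v ∧ L i v ≤ R i u := by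
  classical
  obtain ⟨a, b, hab, h⟩ := exists_integral G A hA hd
  -- Digit positions: a block of `d * A.card` left end points, then one of right end points, each
  -- ordered by dimension and then by rank.
  let idx : Bool × Fin d × A → ℕ := fun x =>
    rank A x.2.2 + x.2.1 * A.card + cond x.1 (d * A.card) 0
  have hlt : ∀ (i : Fin d) (v : A), rank A v + i * A.card < d * A.card := fun i v =>
    add_mul_lt_mul (rank_lt v.2) i.2
  have hidx : Function.Injective idx := by
    rintro ⟨s, i, v⟩ ⟨s', i', v'⟩ heq
    have h₁ := hlt i v
    have h₂ := hlt i' v'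
    have key : s = s' ∧ rank A v + i * A.card = rank A v' + i' * A.card := by
      cases s <;> cases s' <;> simp only [idx, cond_true, cond_false, true_and] at heq ⊢ <;> omega
    obtain ⟨rfl, h₃⟩ := key
    obtain ⟨h₄, h₅⟩ := mul_add_inj (rank_lt v.2) (rank_lt v'.2) h₃
    obtain rfl := Fin.ext h₄
    obtain rfl := Subtype.ext (rank_injOn v.2 v'.2 h₅)
    rfl
  let val : Bool × Fin d × A → ℕ := fun x => cond x.1 (b x.2.1 x.2.2) (a x.2.1 x.2.2)
  -- Injectivity of `idx` makes the digits well defined; the default `0` is a legal digit.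
  let f : ℕ → ℕ := Function.extend idx val 0
  have hf : ∀ t, f t < 4 * A.card + 1 := by
    intro t
    by_cases ht : ∃ x, idx x = t
    · obtain ⟨⟨s, i, v⟩, rfl⟩ := ht
      have := hab i v v.2
      rw [show f _ = val _ from hidx.extend_apply _ _ _]
      cases s <;> simp only [val, cond_true, cond_false] <;> omega
    · rw [show f t = 0 from Function.extend_apply' _ _ _ ht]
      omega
  obtain ⟨c, hc, hct⟩ := exists_digits (4 * A.card + 1) (d * (A.card + A.card)) f hf
  rw [mul_add] at hct
  have hl : ∀ i, ∀ v ∈ A, leftDigit A d c i v = a i v := by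
    intro i v hv
    have := hct (idx (false, i, ⟨v, hv⟩)) (by
      have : rank A v + i * A.card < d * A.card := hlt i ⟨v, hv⟩
      simp only [idx, cond_false]
      omega)
    rw [show f _ = val _ from hidx.extend_apply _ _ _] at this
    exact this
  have hr : ∀ i, ∀ v ∈ A, rightDigit A d c i v = b i v := by
    intro i v hv
    have := hct (idx (true, i, ⟨v, hv⟩)) (by
      have : rank A v + i * A.card < d * A.card := hlt i ⟨v, hv⟩
      simp only [idx, cond_true]
      omega)
    rw [show f _ = val _ from hidx.extend_apply _ _ _] at this
    exact this
  -- `IsExtension` reads the given end points only on `A`, where the digits agree with `a` and `b`.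
  refine ⟨c, hc, fun L R hLR => h L R ⟨fun i v hv => ?_, fun i v hv => ?_, fun i v hv t => ?_,
    fun i v hv t => ?_⟩⟩
  · rw [hLR.left_mem i v hv, hl i v hv]
  · rw [hLR.right_mem i v hv, hr i v hv]
  · rw [hLR.left i v hv]
    exact and_congr_right fun _ => forall₂_congr fun w hw => by rw [hr i w hw]
  · rw [hLR.right i v hv]
    refine and_congr_right fun _ => or_congr_right (exists_congr fun w => and_congr_right fun hw => ?_)
    rw [hl i w hw]

/-! ### The algorithm

The registers `0`, `4`, `5` hold `n`, the size `m` of the set `A` of marked vertices, and `4 m + 1`.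
The register `6` holds a dimension `d`, the register `8` a candidate `c`; the register `12` tells
whether a box representation has been found, and the register `13` its dimension. Array `0` is the
adjacency matrix, array `3` the characteristic function of `A`, the arrays `4` and `7` are tables
of `u * n` and of the powers of `4 m + 1`, the arrays `5` and `6` hold the intervals that the
candidate gives to the vertices of `A`, and the arrays `1` and `2` those of all vertices. -/

/-- The entry of the adjacency matrix. -/
def adjTm (u v : Tm) : Tm := .get 0 (.add (.get 4 u) v)

/-- The indicator of equality. -/
def eqTm (u v : Tm) : Tm := .sub (.const 1) (.add (.sub u v) (.sub v u))

/-- The index `i * n + v`, computed with the bound variable `k`. -/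
def idxTm (k : ℕ) (i v : Tm) : Tm := .add (.sum false k i (.var 0)) v

/-- Tabulate `u * n`. -/
def rowCmd : Cmd := .loop true 2 (.var 0) (.put 4 (.var 2) (.sum true 20 (.var 2) (.var 0)))

/-- Mark the vertices of a maximal matching in the complement of the graph. -/
def markCmd : Cmd :=
  .loop true 2 (.var 0) (.loop true 3 (.var 0)
    -- Register `1` becomes `1` iff the pair is nonadjacent, distinct and unmarked; adding it to
    -- both marks replaces a conditional.
    (.seq (.set 1 (.sub (.const 1) (.add (.add (adjTm (.var 2) (.var 3)) (eqTm (.var 2) (.var 3)))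
      (.add (.get 3 (.var 2)) (.get 3 (.var 3))))))
    (.seq (.put 3 (.var 2) (.add (.get 3 (.var 2)) (.var 1)))
      (.put 3 (.var 3) (.add (.get 3 (.var 3)) (.var 1))))))

/-- The size of the set of marked vertices, and the number of possible end points. -/
def sizeCmd : Cmd :=
  .seq (.set 4 (.sum true 20 (.var 0) (.get 3 (.var 20))))
    (.set 5 (.add (.add (.add (.var 4) (.var 4)) (.add (.var 4) (.var 4))) (.const 1)))

/-- Tabulate powers. -/
def powCmd : Cmd :=
  .seq (.put 7 (.const 0) (.const 1))
    (.loop false 2 (.sum false 20 (.add (.var 4) (.const 1)) (.add (.var 4) (.var 4)))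
      (.put 7 (.add (.var 2) (.const 1)) (.sum false 20 (.var 5) (.get 7 (.var 2)))))

/-- Store the values of `e`, a term in the variables `10` and `11`, in the array `a`. -/
def tabCmd (a : ℕ) (e : Tm) : Cmd :=
  .loop false 10 (.var 6) (.loop true 11 (.var 0) (.put a (idxTm 20 (.var 10) (.var 11)) e))

/-- The quotient of the candidate by the power with exponent `t`. -/
def divTm (t : Tm) : Tm :=
  .sum false 20 (.var 8) (.sub (.const 1)
    (.sub (.sum false 21 (.add (.var 20) (.const 1)) (.get 7 t)) (.var 8)))

/-- The digit of the candidate at the position `t`. -/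
def digitTm (t : Tm) : Tm :=
  .sub (divTm t) (.sum false 20 (divTm (.add t (.const 1))) (.var 5))

/-- The position of the digit for a left end point. -/
def leftPosTm : Tm :=
  .add (.sum true 22 (.var 11) (.get 3 (.var 22))) (.sum false 22 (.var 10) (.var 4))

/-- The position of the digit for a right end point. -/
def rightPosTm : Tm := .add leftPosTm (.sum false 22 (.var 6) (.var 4))

/-- The number of marked neighbours `w` of the vertex `11` at which `x`, a term in the
variable `22`, vanishes. -/
def nbrTm (x : Tm) : Tm :=
  .sum true 22 (.var 0) (.sub (.const 1) (.add (.add (.sub (.const 1) (.get 3 (.var 22)))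
    (.sub (.const 1) (adjTm (.var 11) (.var 22)))) x))

/-- The left end point of the interval of a vertex. -/
def leftTm : Tm :=
  -- A sum over `0` or `1` summands serves as a conditional on the mark of the vertex.
  .add (.sum false 20 (.get 3 (.var 11)) (.get 5 (idxTm 21 (.var 10) (.var 11))))
    (.sum false 20 (.sub (.const 1) (.get 3 (.var 11)))
      (.sum false 21 (.add (.var 4) (.var 4)) (.sub (.const 1)
        (nbrTm (.sub (.get 6 (idxTm 23 (.var 10) (.var 22))) (.var 21))))))

/-- The right end point of the interval of a vertex. -/
def rightTm : Tm :=
  .add (.sum false 20 (.get 3 (.var 11)) (.get 6 (idxTm 21 (.var 10) (.var 11))))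
    (.sum false 20 (.sub (.const 1) (.get 3 (.var 11)))
      -- The double complement reduces the sum expressing a disjunction to `0` or `1`.
      (.sum false 21 (.var 5) (.sub (.const 1) (.sub (.const 1)
        (.add (.sub (.const 1) (.sub (.add (.var 21) (.const 1)) (.add (.var 4) (.var 4))))
          (nbrTm (.sub (.add (.var 21) (.const 1)) (.get 5 (idxTm 23 (.var 10) (.var 22))))))))))

/-- The indicator of the intervals of two vertices meeting in all dimensions. -/
def meetTm : Tm :=
  .sub (.const 1) (.sum false 22 (.var 6)
    (.add (.sub (.get 1 (idxTm 23 (.var 22) (.var 20))) (.get 2 (idxTm 23 (.var 22) (.var 21))))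
      (.sub (.get 1 (idxTm 23 (.var 22) (.var 21))) (.get 2 (idxTm 23 (.var 22) (.var 20))))))

/-- The indicator of adjacency or equality of two vertices. -/
def adjEqTm : Tm := .add (adjTm (.var 20) (.var 21)) (eqTm (.var 20) (.var 21))

/-- The indicator of the intervals forming a box representation. -/
def checkTm : Tm :=
  .sub (.const 1) (.sum true 20 (.var 0) (.sum true 21 (.var 0)
    (.add (.sub adjEqTm meetTm) (.sub meetTm adjEqTm))))

/-- Try a candidate. -/
def tryCmd : Cmd :=
  .seq (tabCmd 5 (digitTm leftPosTm)) (.seq (tabCmd 6 (digitTm rightPosTm))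
    (.seq (tabCmd 1 leftTm) (.seq (tabCmd 2 rightTm)
    (.seq (.set 12 checkTm) (.set 13 (.var 6))))))

/-- Try all candidates, unless a box representation has been found. -/
def searchCmd : Cmd :=
  .loop false 6 (.add (.var 4) (.const 1))
    (.loop false 8 (.get 7 (.sum false 20 (.var 6) (.add (.var 4) (.var 4))))
      -- A loop with at most one round: nothing is tried once register `12` is `1`.
      (.loop false 9 (.sub (.const 1) (.var 12)) tryCmd))

/-- The whole algorithm. -/
def boxCmd : Cmd :=
  .seq rowCmd (.seq markCmd (.seq sizeCmd (.seq powCmd (.seq searchCmd (.set 0 (.var 13))))))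

/-- Variables below `20` belong to commands, those from `20` on are bound by sums. -/
theorem boxCmd_inScope : boxCmd.inScope 20 = true := by decide

/-- The origin of the factor `n^2`: loops over dimensions, candidates and end points carry the other
flag. -/
theorem boxCmd_deg : boxCmd.deg true = 2 := by decide

/-! ### Correctness of the preparations -/

open Classical in
/-- The store holds `n`, the adjacency matrix and the table of `u * n`, and nothing has been
found yet. -/
structure Prepared {n : ℕ} (G : SimpleGraph (Fin n)) (s : Store) : Prop where
  size : s.reg 0 = n
  found : s.reg 12 = 0
  adj : ∀ u v : Fin n, s.arr 0 (u * n + v) = if G.Adj u v then 1 else 0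
  row : ∀ u < n, s.arr 4 u = u * n

/-- Array `3` holds the characteristic function of `A`. -/
def Marks {n : ℕ} (A : Finset (Fin n)) (s : Store) : Prop :=
  ∀ v : Fin n, s.arr 3 v = if v ∈ A then 1 else 0

open Classical in
theorem inputStore_adj {n : ℕ} (G : SimpleGraph (Fin n)) (u v : Fin n) :
    (inputStore G).arr 0 (u * n + v) = if G.Adj u v then 1 else 0 := by
  have : (∃ u' v' : Fin n, G.Adj u' v' ∧ (u : ℕ) * n + v = (u' : ℕ) * n + v') ↔ G.Adj u v := by
    constructor
    · rintro ⟨u', v', h, heq⟩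
      obtain ⟨h₁, h₂⟩ := mul_add_inj (i := u) (i' := u') v.2 v'.2 (by omega)
      rwa [Fin.ext h₁, Fin.ext h₂]
    · exact fun h => ⟨u, v, h, rfl⟩
  simp only [inputStore, true_and, this]

/-- The table lets an adjacency be read in constant time; forming `u * n` by repeated addition
inside a double loop over vertices would cost another factor `n`. -/
theorem rowCmd_ok {n : ℕ} (G : SimpleGraph (Fin n)) (W : ℕ) :
    rowCmd.Ok n W (inputStore G) fun s => Prepared G s ∧ Marks (∅ : Finset (Fin n)) s := by
  refine Cmd.Ok.loop (fun i s => s.reg 0 = n ∧ s.reg 12 = 0 ∧ s.arr 0 = (inputStore G).arr 0 ∧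
    s.arr 3 = (inputStore G).arr 3 ∧ ∀ u < i, s.arr 4 u = u * n) trivial ?_ ?_ ?_ ?_
  · simp [Tm.eval, inputStore]
  · simp [inputStore]
  · rintro i hi s ⟨h0, h12, ha0, ha3, h4⟩
    have hi : i < n := by simpa [Tm.eval, inputStore] using hi
    refine Cmd.Ok.put trivial ⟨trivial, by simpa [Tm.eval] using hi.le, fun _ _ => trivial⟩
      ⟨by simpa using h0, by simpa using h12, ?_, ?_, ?_⟩
    · rw [Store.setArr_arr_of_ne _ _ _ (by decide)]
      exact ha0
    · rw [Store.setArr_arr_of_ne _ _ _ (by decide)]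
      exact ha3
    · intro u hu
      by_cases h : u = i
      · simp [Store.setArr_arr, Tm.eval, h0, h]
      · simp [Store.setArr_arr, Tm.eval, h, h4 u (by omega)]
  · rintro s ⟨h0, h12, ha0, ha3, h4⟩
    refine ⟨⟨h0, h12, fun u v => ?_, fun u hu => h4 u (by simpa [Tm.eval, inputStore] using hu)⟩,
      fun v => ?_⟩
    · rw [ha0, inputStore_adj]
    · rw [ha3]
      simp [inputStore]

theorem Prepared.adjTm_eval {n : ℕ} {G : SimpleGraph (Fin n)} {s : Store} [DecidableRel G.Adj]
    (h : Prepared G s) {e f : Tm} {u v : Fin n} (he : e.eval s = u) (hf : f.eval s = v) :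
    (adjTm e f).eval s = if G.Adj u v then 1 else 0 := by
  simp only [adjTm, Tm.eval, he, hf, h.row u u.2, h.adj u v]
  congr

theorem eqTm_eval {n : ℕ} {s : Store} {e f : Tm} {u v : Fin n} (he : e.eval s = u)
    (hf : f.eval s = v) : (eqTm e f).eval s = if u = v then 1 else 0 := by
  simp only [eqTm, Tm.eval, he, hf, Fin.ext_iff]
  split_ifs <;> omega

theorem Prepared.congr {n : ℕ} {G : SimpleGraph (Fin n)} {s s' : Store} (h : Prepared G s)
    (h0 : s'.reg 0 = s.reg 0) (h12 : s'.reg 12 = s.reg 12) (ha0 : s'.arr 0 = s.arr 0)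
    (ha4 : s'.arr 4 = s.arr 4) : Prepared G s' :=
  ⟨h0 ▸ h.size, h12 ▸ h.found, ha0 ▸ h.adj, ha4 ▸ h.row⟩

/-- Every clique misses at least half of `A`. -/
def HalfFree {n : ℕ} (G : SimpleGraph (Fin n)) (A : Finset (Fin n)) : Prop :=
  ∀ S : Finset (Fin n), G.IsClique (S : Set (Fin n)) → A.card ≤ 2 * (A \ S).card

/-- No clique contains both ends of a non-edge, so while `A` grows by two, the part missed by a
clique grows by at least one. -/
theorem HalfFree.insert_pair {n : ℕ} {G : SimpleGraph (Fin n)} {A : Finset (Fin n)} (h : HalfFree G A)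
    {u v : Fin n} (hu : u ∉ A) (hv : v ∉ A) (huv : u ≠ v) (hadj : ¬ G.Adj u v) :
    HalfFree G (insert u (insert v A)) := by
  intro S hS
  have h₁ := h S hS
  rw [Finset.card_insert_of_notMem (by simp [huv, hu]), Finset.card_insert_of_notMem hv]
  suffices h₂ : (A \ S).card + 1 ≤ (insert u (insert v A) \ S).card by omega
  obtain ⟨w, hw, hwA, hwS⟩ : ∃ w, w ∈ insert u (insert v A) ∧ w ∉ A ∧ w ∉ S := by
    by_contra! hc
    exact hadj (hS (hc u (by simp) hu) (hc v (by simp) hv) huv)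
  rw [← Finset.card_insert_of_notMem (a := w) (s := A \ S) (by simp [hwA])]
  refine Finset.card_le_card fun x hx => ?_
  simp only [Finset.mem_insert, Finset.mem_sdiff] at hx hw ⊢
  rcases hx with rfl | hx
  · exact ⟨hw, hwS⟩
  · exact ⟨Or.inr (Or.inr hx.1), hx.2⟩

theorem markCmd_ok {n : ℕ} {G : SimpleGraph (Fin n)} {W : ℕ} {s : Store} (hs : Prepared G s)
    (h3 : Marks (∅ : Finset (Fin n)) s) :
    markCmd.Ok n W s fun s' => Prepared G s' ∧ ∃ A : Finset (Fin n), Marks A s' ∧ HalfFree G A ∧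
      ∀ u v, u ∉ A → v ∉ A → u ≠ v → G.Adj u v := by
  classical
  -- `D` holds for the pairs examined so far. Marks are never removed, so a pair once settled stays
  -- settled.
  let J : (Fin n → Fin n → Prop) → Store → Prop := fun D s' => Prepared G s' ∧
    ∃ A : Finset (Fin n), Marks A s' ∧ HalfFree G A ∧
      ∀ u v, D u v → u ∉ A → v ∉ A → u ≠ v → G.Adj u v
  have hJ : ∀ {D s'} (x y : ℕ), J D s' → x ≠ 0 → x ≠ 12 → J D (s'.setReg x y) := by
    rintro D s' x y ⟨hp, hA⟩ h0 h12
    exact ⟨hp.congr (by simp [h0.symm]) (by simp [h12.symm]) rfl rfl, hA⟩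
  refine Cmd.Ok.loop (fun i => J fun u _ => (u : ℕ) < i) trivial hs.size.le
    ⟨hs, ∅, h3, fun S _ => by simp, by simp⟩ ?_ ?_
  · intro i hi s₁ h₁
    have hi : i < n := lt_of_lt_of_eq hi hs.size
    refine Cmd.Ok.loop (fun j s' => s'.reg 2 = i ∧
      J (fun u v => (u : ℕ) < i ∨ (u : ℕ) = i ∧ (v : ℕ) < j) s') trivial ?_ ?_ ?_ ?_
    · simpa [Tm.eval] using h₁.1.size.le
    · refine ⟨by simp, hJ 2 i ?_ (by decide) (by decide)⟩
      simpa using h₁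
    · rintro j hj s₂ ⟨hi₂, h₂⟩
      have hj : j < n := by simpa [Tm.eval, h₁.1.size] using hj
      obtain ⟨hp, A, hA, hhalf, hD⟩ := hJ 3 j h₂ (by decide) (by decide)
      have hi₃ : (s₂.setReg 3 j).reg 2 = i := by simpa using hi₂
      have hj₃ : (s₂.setReg 3 j).reg 3 = j := by simp
      generalize s₂.setReg 3 j = s₃ at hp hA hi₃ hj₃
      have hc : ((Tm.sub (.const 1) (.add (.add (adjTm (.var 2) (.var 3))
          (eqTm (.var 2) (.var 3))) (.add (.get 3 (.var 2)) (.get 3 (.var 3))))).eval s₃) =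
          if (⟨i, hi⟩ : Fin n) ∉ A ∧ (⟨j, hj⟩ : Fin n) ∉ A ∧ (⟨i, hi⟩ : Fin n) ≠ ⟨j, hj⟩ ∧
            ¬ G.Adj ⟨i, hi⟩ ⟨j, hj⟩ then 1 else 0 := by
        have e₁ := hA ⟨i, hi⟩
        have e₂ := hA ⟨j, hj⟩
        simp only at e₁ e₂
        simp only [Tm.eval, hp.adjTm_eval (e := .var 2) (f := .var 3) (u := ⟨i, hi⟩) (v := ⟨j, hj⟩)
          hi₃ hj₃, eqTm_eval (e := .var 2) (f := .var 3) (u := ⟨i, hi⟩) (v := ⟨j, hj⟩) hi₃ hj₃,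
          hi₃, hj₃, e₁, e₂]
        split_ifs <;> first | rfl | (exfalso; tauto)
      refine Cmd.Ok.seq (Cmd.Ok.set (by simp [Tm.Fits, adjTm, eqTm]) (Cmd.Ok.seq
        (Cmd.Ok.put trivial ⟨trivial, trivial⟩ (Cmd.Ok.put trivial ⟨trivial, trivial⟩ ?_))))
      rw [hc]
      simp only [Tm.eval, Store.setArr_reg, Store.setReg_reg, Store.setReg_arr, hi₃, hj₃,
        if_true, if_false, show (2 : ℕ) ≠ 1 by decide, show (3 : ℕ) ≠ 1 by decide]
      refine ⟨trivial, hp.congr rfl rfl ?_ ?_, ?_⟩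
      · rw [Store.setArr_arr_of_ne _ _ _ (by decide), Store.setArr_arr_of_ne _ _ _ (by decide)]
        rfl
      · rw [Store.setArr_arr_of_ne _ _ _ (by decide), Store.setArr_arr_of_ne _ _ _ (by decide)]
        rfl
      · split_ifs with hcond
        · obtain ⟨hiA, hjA, hij, hadj⟩ := hcond
          have hij' : j ≠ i := fun h => hij (Fin.ext h.symm)
          refine ⟨insert ⟨i, hi⟩ (insert ⟨j, hj⟩ A), fun v => ?_, hhalf.insert_pair hiA hjA hij hadj,
            fun u v huv hu hv hne => ?_⟩
          · have e₁ := hA ⟨i, hi⟩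
            have e₂ := hA ⟨j, hj⟩
            simp only [hiA, hjA, if_false] at e₁ e₂
            simp only [Store.setArr_arr, Store.setReg_arr, true_and, hij', if_false, e₁, e₂, hA v,
              Finset.mem_insert, Fin.ext_iff]
            split_ifs <;> first | rfl | (exfalso; tauto)
          · simp only [Finset.mem_insert, not_or] at hu hv
            refine hD u v ?_ hu.2.2 hv.2.2 hne
            rcases huv with h | h
            · exact Or.inl h
            · exact (hu.1 (Fin.ext h.1)).elim
        · refine ⟨A, fun v => ?_, hhalf, fun u v huv hu hv hne => ?_⟩
          · simp only [Store.setArr_arr, Store.setReg_arr, true_and, add_zero]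
            rw [← hA v]
            split_ifs <;> simp_all
          · by_cases hlast : (u : ℕ) = i ∧ (v : ℕ) = j
            · obtain rfl : u = ⟨i, hi⟩ := Fin.ext hlast.1
              obtain rfl : v = ⟨j, hj⟩ := Fin.ext hlast.2
              by_contra hc
              exact hcond ⟨hu, hv, hne, hc⟩
            · exact hD u v (by omega) hu hv hne
    · rintro s₂ ⟨-, hp, A, hA, hhalf, hD⟩
      refine ⟨hp, A, hA, hhalf, fun u v huv => hD u v ?_⟩
      have : v < (Tm.var 0).eval (s₁.setReg 2 i) := by
        simp [Tm.eval, h₁.1.size]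
      omega
  · rintro s₁ ⟨hp, A, hA, hhalf, hD⟩
    exact ⟨hp, A, hA, hhalf, fun u v => hD u v (lt_of_lt_of_eq u.2 hs.size.symm)⟩

/-- The store is ready for the search with the set `A` of marked vertices. -/
structure Ready {n : ℕ} (G : SimpleGraph (Fin n)) (A : Finset (Fin n)) (s : Store) : Prop where
  size : s.reg 0 = n
  adj : ∀ [DecidableRel G.Adj] (u v : Fin n), s.arr 0 (u * n + v) = if G.Adj u v then 1 else 0
  row : ∀ u < n, s.arr 4 u = u * n
  marks : ∀ v : Fin n, s.arr 3 v = if v ∈ A then 1 else 0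
  card : s.reg 4 = A.card
  base : s.reg 5 = 4 * A.card + 1
  pow : ∀ t ≤ (A.card + 1) * (A.card + A.card), s.arr 7 t = (4 * A.card + 1) ^ t

/-- The number `W` bounds all numbers of rounds that depend on `m` only. -/
structure Ample (m W : ℕ) : Prop where
  base : 4 * m + 1 ≤ W
  exponent : (m + 1) * (m + m) ≤ W
  succ : m + 1 ≤ W
  pow : ∀ t ≤ (m + 1) * (m + m), (4 * m + 1) ^ t ≤ W

theorem sizeCmd_powCmd_ok {n : ℕ} {G : SimpleGraph (Fin n)} {A : Finset (Fin n)} {W : ℕ}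
    (hW : Ample A.card W) {s : Store} (hs : Prepared G s) (hA : Marks A s) {q : Cmd}
    {Q : Store → Prop} (hQ : ∀ s', Ready G A s' → s'.reg 12 = 0 → q.Ok n W s' Q) :
    (Cmd.seq sizeCmd (.seq powCmd q)).Ok n W s Q := by
  have hcard : (Tm.sum true 20 (.var 0) (.get 3 (.var 20))).eval s = A.card := by
    simp only [Tm.eval, hs.size, Store.setReg_arr, Store.setReg_reg, if_true]
    rw [sum_range_mem A hA le_rfl]
    congr 1
    exact Finset.filter_true_of_mem fun v _ => v.2
  refine Cmd.Ok.seq (Cmd.Ok.seq (Cmd.Ok.set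
    ⟨trivial, by simp [Tm.eval, hs.size], fun _ _ => trivial⟩ ?_))
  rw [hcard]
  refine Cmd.Ok.set ⟨⟨⟨trivial, trivial⟩, trivial, trivial⟩, trivial⟩ ?_
  have h₀ : Prepared G ((s.setReg 4 A.card).setReg 5 (4 * A.card + 1)) :=
    hs.congr (by simp) (by simp) rfl rfl
  have hA₀ : Marks A ((s.setReg 4 A.card).setReg 5 (4 * A.card + 1)) := hA
  have h4 : ((s.setReg 4 A.card).setReg 5 (4 * A.card + 1)).reg 4 = A.card := by simp
  have h5 : ((s.setReg 4 A.card).setReg 5 (4 * A.card + 1)).reg 5 = 4 * A.card + 1 := by simp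
  rw [show (Tm.add (.add (.add (.var 4) (.var 4)) (.add (.var 4) (.var 4))) (.const 1)).eval
    (s.setReg 4 A.card) = 4 * A.card + 1 by simp only [Tm.eval, Store.setReg_reg, if_true]; ring]
  generalize (s.setReg 4 A.card).setReg 5 (4 * A.card + 1) = s₀ at h₀ hA₀ h4 h5
  have hN : ∀ s : Store, s.reg 4 = A.card →
      (Tm.sum false 20 (.add (.var 4) (.const 1)) (.add (.var 4) (.var 4))).eval s =
        (A.card + 1) * (A.card + A.card) := by
    intro s h4
    simp [Tm.eval, h4]
  have hN₀ := hN (s₀.setArr 7 0 1) (by simpa using h4)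
  refine Cmd.Ok.seq (Cmd.Ok.seq (Cmd.Ok.put trivial trivial ?_))
  refine Cmd.Ok.loop (fun i s' => Prepared G s' ∧ Marks A s' ∧ s'.reg 4 = A.card ∧
    s'.reg 5 = 4 * A.card + 1 ∧ ∀ t ≤ i, s'.arr 7 t = (4 * A.card + 1) ^ t)
    ⟨⟨trivial, trivial⟩, ?_, fun _ _ => ⟨trivial, trivial⟩⟩ ?_ ⟨?_, ?_, h4, h5, ?_⟩ ?_ ?_
  · simpa [Tm.eval, h4] using hW.succ
  · exact hN₀.le.trans hW.exponent
  · refine h₀.congr rfl rfl ?_ ?_ <;> rw [Store.setArr_arr_of_ne _ _ _ (by decide)]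
  · intro v
    rw [Store.setArr_arr_of_ne _ _ _ (by decide)]
    exact hA₀ v
  · intro t ht
    obtain rfl : t = 0 := by omega
    simp [Store.setArr_arr, Tm.eval]
  · rintro i hi s₁ ⟨hp, hA₁, h4₁, h5₁, hpow⟩
    refine Cmd.Ok.put ⟨trivial, trivial⟩ ⟨trivial, by simpa [Tm.eval, h5₁] using hW.base,
      fun _ _ => trivial⟩ ⟨?_, ?_, by simpa using h4₁, by simpa using h5₁, ?_⟩
    · refine hp.congr (by simp) (by simp) ?_ ?_ <;>
        rw [Store.setArr_arr_of_ne _ _ _ (by decide)] <;> rfl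
    · intro v
      rw [Store.setArr_arr_of_ne _ _ _ (by decide)]
      exact hA₁ v
    · intro t ht
      by_cases h : t = i + 1
      · simp [Store.setArr_arr, Tm.eval, h, hpow i le_rfl, h5₁, pow_succ']
      · simp [Store.setArr_arr, Tm.eval, h, hpow t (by omega)]
  · rintro s₁ ⟨hp, hA₁, h4₁, h5₁, hpow⟩
    refine hQ s₁ ⟨hp.size, fun u v => ?_, hp.row, hA₁, h4₁, h5₁, fun t ht => hpow t ?_⟩ hp.found
    · rw [hp.adj u v]
      congr
    · exact ht.trans hN₀.ge

/-! ### Correctness of the search -/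

/-- The stores agree, except for the registers `10` and `11` and the array `a`. -/
structure Agree (a : ℕ) (s s' : Store) : Prop where
  reg : ∀ y, y ≠ 10 → y ≠ 11 → s'.reg y = s.reg y
  arr : ∀ b, b ≠ a → s'.arr b = s.arr b

theorem Agree.setReg {a : ℕ} {s s' : Store} (h : Agree a s s') {x : ℕ} (hx : x = 10 ∨ x = 11)
    (v : ℕ) : Agree a s (s'.setReg x v) :=
  ⟨fun y h10 h11 => by rw [Store.setReg_reg, if_neg (by omega), h.reg y h10 h11], h.arr⟩

theorem idxTm_eval {k : ℕ} (hk : k ≠ 0) (i v : Tm) (s : Store) :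
    (idxTm k i v).eval s = i.eval s * s.reg 0 + v.eval s := by
  simp [idxTm, Tm.eval, hk.symm]

theorem idxTm_fits {k n W : ℕ} {i v : Tm} {s : Store} (hi : i.Fits n W s) (hv : v.Fits n W s)
    (h : i.eval s ≤ W) : (idxTm k i v).Fits n W s :=
  ⟨⟨hi, h, fun _ _ => trivial⟩, hv⟩

/-- The hypothesis on `e` ranges over all stores that differ only in the loop variables and in the
array being written, so the entries already stored cannot influence later ones. -/
theorem tabCmd_ok {n W d a : ℕ} {e : Tm} {s : Store} (h0 : s.reg 0 = n) (h6 : s.reg 6 = d)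
    (hd : d ≤ W) (P : Fin d → Fin n → ℕ → Prop)
    (he : ∀ s', Agree a s s' → ∀ (i : Fin d) (v : Fin n), s'.reg 10 = i → s'.reg 11 = v →
      e.Fits n W s' ∧ P i v (e.eval s')) :
    (tabCmd a e).Ok n W s fun s' => Agree a s s' ∧ ∀ i v, P i v (s'.arr a (i * n + v)) := by
  refine Cmd.Ok.loop (fun i s' => Agree a s s' ∧ ∀ (i' : Fin d) v, (i' : ℕ) < i →
    P i' v (s'.arr a (i' * n + v))) trivial (h6.le.trans hd)
    ⟨⟨fun _ _ _ => rfl, fun _ _ => rfl⟩, fun _ _ h => absurd h (Nat.not_lt_zero _)⟩ ?_ ?_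
  · rintro i hi s₁ ⟨hs₁, hP₁⟩
    have hi : i < d := lt_of_lt_of_eq hi h6
    have h0' : (s₁.setReg 10 i).reg 0 = n := ((hs₁.setReg (Or.inl rfl) i).reg 0 (by decide)
      (by decide)).trans h0
    refine Cmd.Ok.loop (fun j s' => Agree a s s' ∧ s'.reg 10 = i ∧ ∀ (i' : Fin d) (v : Fin n),
      ((i' : ℕ) < i ∨ (i' : ℕ) = i ∧ (v : ℕ) < j) → P i' v (s'.arr a (i' * n + v))) trivial
      h0'.le ⟨hs₁.setReg (Or.inl rfl) i, by simp, ?_⟩ ?_ ?_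
    · intro i' v h
      exact hP₁ i' v (by omega)
    · rintro j hj s₂ ⟨hs₂, hi₂, hP₂⟩
      have hj : j < n := lt_of_lt_of_eq hj h0'
      have hs₃ := hs₂.setReg (Or.inr rfl) j
      have hi₃ : (s₂.setReg 11 j).reg 10 = i := by simpa using hi₂
      have hj₃ : (s₂.setReg 11 j).reg 11 = j := by simp
      have hP₃ : ∀ (i' : Fin d) (v : Fin n), ((i' : ℕ) < i ∨ (i' : ℕ) = i ∧ (v : ℕ) < j) →
        P i' v ((s₂.setReg 11 j).arr a (i' * n + v)) := hP₂
      generalize s₂.setReg 11 j = s₃ at hs₃ hi₃ hj₃ hP₃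
      obtain ⟨hf, hPe⟩ := he s₃ hs₃ ⟨i, hi⟩ ⟨j, hj⟩ hi₃ hj₃
      have h0₃ : s₃.reg 0 = n := (hs₃.reg 0 (by decide) (by decide)).trans h0
      refine Cmd.Ok.put (idxTm_fits trivial trivial (hi₃.le.trans (hi.le.trans hd))) hf
        ⟨⟨hs₃.reg, fun b hb => ?_⟩, hi₃, fun i' v h => ?_⟩
      · rw [Store.setArr_arr_of_ne _ _ _ hb, hs₃.arr b hb]
      · rw [idxTm_eval (by decide), Store.setArr_arr]
        simp only [Tm.eval, hi₃, hj₃, h0₃, true_and]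
        split_ifs with heq
        · obtain ⟨h₁, h₂⟩ := mul_add_inj (i := i') (i' := i) v.2 hj (by omega)
          obtain rfl : i' = ⟨i, hi⟩ := Fin.ext h₁
          obtain rfl : v = ⟨j, hj⟩ := Fin.ext h₂
          exact hPe
        · refine hP₃ i' v ?_
          by_contra hc
          obtain ⟨h₁, h₂⟩ : (i' : ℕ) = i ∧ (v : ℕ) = j := by omega
          exact heq (by rw [h₁, h₂])
    · rintro s₂ ⟨hs₂, -, hP₂⟩
      refine ⟨hs₂, fun i' v h => hP₂ i' v ?_⟩
      have : (v : ℕ) < (Tm.var 0).eval (s₁.setReg 10 i) := lt_of_lt_of_eq v.2 h0'.symm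
      omega
  · rintro s₁ ⟨hs₁, hP₁⟩
    exact ⟨hs₁, fun i v => hP₁ i v (lt_of_lt_of_eq i.2 h6.symm)⟩

theorem Ready.congr {n : ℕ} {G : SimpleGraph (Fin n)} {A : Finset (Fin n)} {s s' : Store}
    (h : Ready G A s) (h0 : s'.reg 0 = s.reg 0) (h4 : s'.reg 4 = s.reg 4)
    (h5 : s'.reg 5 = s.reg 5) (ha0 : s'.arr 0 = s.arr 0) (ha3 : s'.arr 3 = s.arr 3)
    (ha4 : s'.arr 4 = s.arr 4) (ha7 : s'.arr 7 = s.arr 7) : Ready G A s' := by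
  refine ⟨h0 ▸ h.size, fun u v => ?_, ha4 ▸ h.row, ha3 ▸ h.marks, h4 ▸ h.card, h5 ▸ h.base,
    ha7 ▸ h.pow⟩
  rw [ha0, h.adj u v]

theorem Ready.setReg {n : ℕ} {G : SimpleGraph (Fin n)} {A : Finset (Fin n)} {s : Store}
    (h : Ready G A s) {x : ℕ} (hx : 5 < x) (v : ℕ) : Ready G A (s.setReg x v) := by
  apply h.congr <;> first | rfl | (rw [Store.setReg_reg, if_neg (by omega)])

theorem Ready.agree {n : ℕ} {G : SimpleGraph (Fin n)} {A : Finset (Fin n)} {s s' : Store} {a : ℕ}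
    (h : Ready G A s) (h' : Agree a s s') (ha : a ≠ 0 ∧ a ≠ 3 ∧ a ≠ 4 ∧ a ≠ 7) : Ready G A s' :=
  h.congr (h'.reg _ (by decide) (by decide)) (h'.reg _ (by decide) (by decide))
    (h'.reg _ (by decide) (by decide)) (h'.arr _ ha.1.symm) (h'.arr _ ha.2.1.symm)
    (h'.arr _ ha.2.2.1.symm) (h'.arr _ ha.2.2.2.symm)

/-! ### Values of the terms used in the search -/

section Terms

variable {n : ℕ} {G : SimpleGraph (Fin n)} {A : Finset (Fin n)} {W : ℕ} {s : Store}

theorem Ready.adjTm_eval [DecidableRel G.Adj] (h : Ready G A s) {e f : Tm} {u v : Fin n}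
    (he : e.eval s = u) (hf : f.eval s = v) :
    (adjTm e f).eval s = if G.Adj u v then 1 else 0 := by
  simp only [adjTm, Tm.eval, he, hf, h.row u u.2, h.adj u v]

theorem divTm_ok (hs : Ready G A s) {t : Tm} {T : ℕ}
    (hT : T ≤ (A.card + 1) * (A.card + A.card)) (hc : s.reg 8 ≤ W)
    (ht : ∀ j y, t.Fits n W ((s.setReg 20 j).setReg 21 y) ∧
      t.eval ((s.setReg 20 j).setReg 21 y) = T) :
    (divTm t).Fits n W s ∧ (divTm t).eval s = s.reg 8 / (4 * A.card + 1) ^ T := by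
  constructor
  · refine ⟨trivial, hc, fun j hj => ⟨trivial, ⟨⟨trivial, trivial⟩, ?_, fun y _ => (ht j y).1⟩,
      trivial⟩⟩
    have : j < s.reg 8 := hj
    simp only [Tm.eval, Store.setReg_reg, if_true, cond_false]
    omega
  · rw [← sum_range_div (by positivity)]
    simp [divTm, Tm.eval, (ht _ _).2, hs.pow T hT]

/-- The remainder is obtained from the quotients by two consecutive powers; the strict bound on `T`
keeps `T + 1` inside the table of powers. -/
theorem digitTm_ok (hs : Ready G A s) {t : Tm} {T : ℕ}
    (hT : T < (A.card + 1) * (A.card + A.card)) (hc : s.reg 8 ≤ W)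
    (ht : ∀ j y, t.Fits n W ((s.setReg 20 j).setReg 21 y) ∧
      t.eval ((s.setReg 20 j).setReg 21 y) = T) :
    (digitTm t).Fits n W s ∧
      (digitTm t).eval s = s.reg 8 / (4 * A.card + 1) ^ T % (4 * A.card + 1) := by
  obtain ⟨f₁, e₁⟩ := divTm_ok hs hT.le hc ht
  obtain ⟨f₂, e₂⟩ := divTm_ok hs (t := t.add (.const 1)) (T := T + 1) hT hc
    fun j y => ⟨⟨(ht j y).1, trivial⟩, by rw [Tm.eval, (ht j y).2]; rfl⟩
  constructor
  · refine ⟨f₁, f₂, ?_, fun _ _ => trivial⟩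
    rw [e₂]
    exact (Nat.div_le_self _ _).trans hc
  · simp only [digitTm, Tm.eval, e₁, e₂, Store.setReg_reg, hs.base]
    rw [Nat.mod_eq_sub_mul_div, Nat.div_div_eq_div_mul, pow_succ]
    simp [mul_comm]

theorem leftPosTm_ok (hs : Ready G A s) {d : ℕ} (hd : d ≤ W) {i : Fin d} {v : Fin n}
    (h10 : s.reg 10 = i) (h11 : s.reg 11 = v) :
    leftPosTm.Fits n W s ∧ leftPosTm.eval s = rank A v + i * A.card := by
  constructor
  · exact ⟨⟨trivial, h11.le.trans v.2.le, fun _ _ => trivial⟩, trivial,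
      h10.le.trans (i.2.le.trans hd), fun _ _ => trivial⟩
  · have : ∑ w ∈ Finset.range v, s.arr 3 w = rank A v := sum_range_mem A hs.marks v.2.le
    simp [leftPosTm, Tm.eval, h10, h11, this, hs.card]

theorem rightPosTm_ok (hs : Ready G A s) {d : ℕ} (hd : d ≤ W) {i : Fin d} {v : Fin n}
    (h6 : s.reg 6 = d) (h10 : s.reg 10 = i) (h11 : s.reg 11 = v) :
    rightPosTm.Fits n W s ∧ rightPosTm.eval s = rank A v + i * A.card + d * A.card := by
  obtain ⟨f, e⟩ := leftPosTm_ok hs hd h10 h11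
  refine ⟨⟨f, trivial, h6.le.trans hd, fun _ _ => trivial⟩, ?_⟩
  rw [rightPosTm, Tm.eval, e]
  simp [Tm.eval, h6, hs.card]

/-- A universal quantifier over marked neighbours, realised as the vanishing of a sum of indicators
of counterexamples. -/
theorem nbrTm_ok (hs : Ready G A s) {v : Fin n} (h11 : s.reg 11 = v) {x : Tm}
    (hx : ∀ w < n, x.Fits n W (s.setReg 22 w)) :
    (nbrTm x).Fits n W s ∧ ((nbrTm x).eval s = 0 ↔
      ∀ w ∈ A, G.Adj v w → x.eval (s.setReg 22 w) ≠ 0) := by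
  classical
  have h0 := hs.size
  constructor
  · exact ⟨trivial, h0.le, fun w hw => ⟨trivial, ⟨⟨trivial, trivial⟩, trivial, trivial, trivial⟩,
      hx w (lt_of_lt_of_eq hw h0)⟩⟩
  · rw [nbrTm, Tm.eval, Finset.sum_eq_zero_iff]
    simp only [Finset.mem_range]
    rw [show (Tm.var 0).eval s = n from h0]
    have key : ∀ w : Fin n, (Tm.sub (.const 1) (.add (.add (.sub (.const 1) (.get 3 (.var 22)))
        (.sub (.const 1) (adjTm (.var 11) (.var 22)))) x)).eval (s.setReg 22 w) = 0 ↔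
        (w ∈ A → G.Adj v w → x.eval (s.setReg 22 w) ≠ 0) := by
      intro w
      have hs' := hs.setReg (x := 22) (by decide) w
      have h₁ := hs'.adjTm_eval (e := .var 11) (f := .var 22) (u := v) (v := w)
        (by simpa [Tm.eval] using h11) (by simp [Tm.eval])
      have h₂ := hs.marks w
      simp only [Tm.eval, h₁, Store.setReg_reg, if_true, Store.setReg_arr, h₂]
      by_cases hw : w ∈ A <;> by_cases hvw : G.Adj v w <;> simp [hw, hvw] <;> omega
    exact ⟨fun h w => (key w).1 (h w w.2), fun h w hw => (key ⟨w, hw⟩).2 (h ⟨w, hw⟩)⟩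

theorem leftTm_ok (hW : Ample A.card W) (hs : Ready G A s) {d : ℕ} (hd : d ≤ W) {i : Fin d}
    {v : Fin n} (h10 : s.reg 10 = i) (h11 : s.reg 11 = v) :
    leftTm.Fits n W s ∧ (v ∈ A → leftTm.eval s = s.arr 5 (i * n + v)) ∧
      (v ∉ A → ∀ t, t < leftTm.eval s ↔
        t < 2 * A.card ∧ ∀ w ∈ A, G.Adj v w → t < s.arr 6 (i * n + w)) := by
  have hi : (i : ℕ) ≤ W := i.2.le.trans hd
  have h₁ := hW.base
  have hn : ∀ j t, (nbrTm (.sub (.get 6 (idxTm 23 (.var 10) (.var 22))) (.var 21))).Fits n W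
      ((s.setReg 20 j).setReg 21 t) ∧
      ((nbrTm (.sub (.get 6 (idxTm 23 (.var 10) (.var 22))) (.var 21))).eval
      ((s.setReg 20 j).setReg 21 t) = 0 ↔ ∀ w ∈ A, G.Adj v w → t < s.arr 6 (i * n + w)) := by
    intro j t
    have := nbrTm_ok (W := W) ((hs.setReg (x := 20) (by decide) j).setReg (x := 21) (by decide) t)
      (v := v) (by simpa using h11) (x := .sub (.get 6 (idxTm 23 (.var 10) (.var 22))) (.var 21))
      fun w _ => ⟨idxTm_fits trivial trivial (by simpa [Tm.eval, h10] using hi), trivial⟩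
    refine ⟨this.1, this.2.trans (forall₃_congr fun w _ _ => ?_)⟩
    simp [Tm.eval, idxTm_eval, h10, hs.size]
    omega
  have hmark := hs.marks v
  refine ⟨⟨⟨trivial, ?_, fun _ _ => idxTm_fits trivial trivial ?_⟩, ⟨trivial, trivial⟩, ?_,
    fun j _ => ⟨⟨trivial, trivial⟩, ?_, fun t _ => ⟨trivial, (hn j t).1⟩⟩⟩, fun hv => ?_,
    fun hv t => ?_⟩
  · simp only [Tm.eval, h11, hmark, cond_false]
    split_ifs <;> omega
  · simpa [Tm.eval, h10] using hi
  · simp only [Tm.eval, cond_false]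
    omega
  · simp [Tm.eval, hs.card]
    omega
  · simp [leftTm, Tm.eval, h11, hmark, hv, idxTm_eval, h10, hs.size]
  · rw [two_mul]
    have : leftTm.eval s = ∑ t ∈ Finset.range (A.card + A.card),
        (1 - (nbrTm (.sub (.get 6 (idxTm 23 (.var 10) (.var 22))) (.var 21))).eval
          ((s.setReg 20 0).setReg 21 t)) := by
      simp [leftTm, Tm.eval, h11, hmark, hv, hs.card]
    rw [this]
    refine lt_sum_range_iff (Q := fun t => ∀ w ∈ A, G.Adj v w → t < s.arr 6 (i * n + w))
      (fun t t' htt' h w hw hvw => htt'.trans_lt (h w hw hvw)) (fun t _ h => ?_) (fun t _ h => ?_) t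
    · rw [((hn 0 t).2).2 h]
    · have := mt ((hn 0 t).2).1 h
      omega

theorem rightTm_ok (hW : Ample A.card W) (hs : Ready G A s) {d : ℕ} (hd : d ≤ W) {i : Fin d}
    {v : Fin n} (h10 : s.reg 10 = i) (h11 : s.reg 11 = v) :
    rightTm.Fits n W s ∧ (v ∈ A → rightTm.eval s = s.arr 6 (i * n + v)) ∧
      (v ∉ A → ∀ t, t < rightTm.eval s ↔ t < 4 * A.card + 1 ∧
        (t < 2 * A.card ∨ ∃ w ∈ A, G.Adj v w ∧ t < s.arr 5 (i * n + w))) := by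
  have hi : (i : ℕ) ≤ W := i.2.le.trans hd
  have h₁ := hW.base
  have hn : ∀ j t, (nbrTm (.sub (.add (.var 21) (.const 1))
      (.get 5 (idxTm 23 (.var 10) (.var 22))))).Fits n W ((s.setReg 20 j).setReg 21 t) ∧
      ((nbrTm (.sub (.add (.var 21) (.const 1)) (.get 5 (idxTm 23 (.var 10) (.var 22))))).eval
      ((s.setReg 20 j).setReg 21 t) = 0 ↔
        ¬ ∃ w ∈ A, G.Adj v w ∧ t < s.arr 5 (i * n + w)) := by
    intro j t
    have := nbrTm_ok (W := W) ((hs.setReg (x := 20) (by decide) j).setReg (x := 21) (by decide) t)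
      (v := v) (by simpa using h11)
      (x := .sub (.add (.var 21) (.const 1)) (.get 5 (idxTm 23 (.var 10) (.var 22))))
      fun w _ => ⟨⟨trivial, trivial⟩, idxTm_fits trivial trivial (by simpa [Tm.eval, h10] using hi)⟩
    refine ⟨this.1, this.2.trans ?_⟩
    push Not
    refine forall₃_congr fun w _ _ => ?_
    simp [Tm.eval, idxTm_eval, h10, hs.size]
    omega
  have hmark := hs.marks v
  refine ⟨⟨⟨trivial, ?_, fun _ _ => idxTm_fits trivial trivial ?_⟩, ⟨trivial, trivial⟩, ?_,
    fun j _ => ⟨trivial, ?_, fun t _ => ⟨trivial, trivial, ⟨trivial, ⟨trivial, trivial⟩, trivial,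
    trivial⟩, (hn j t).1⟩⟩⟩, fun hv => ?_, fun hv t => ?_⟩
  · simp only [Tm.eval, h11, hmark, cond_false]
    split_ifs <;> omega
  · simpa [Tm.eval, h10] using hi
  · simp only [Tm.eval, cond_false]
    omega
  · simpa [Tm.eval, hs.base] using h₁
  · simp [rightTm, Tm.eval, h11, hmark, hv, idxTm_eval, h10, hs.size]
  · have : rightTm.eval s = ∑ t ∈ Finset.range (4 * A.card + 1),
        (1 - (1 - ((1 - (t + 1 - (A.card + A.card))) +
          (nbrTm (.sub (.add (.var 21) (.const 1)) (.get 5 (idxTm 23 (.var 10) (.var 22))))).eval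
          ((s.setReg 20 0).setReg 21 t)))) := by
      simp [rightTm, Tm.eval, h11, hmark, hv, hs.card, hs.base]
    rw [this]
    refine lt_sum_range_iff
      (Q := fun t => t < 2 * A.card ∨ ∃ w ∈ A, G.Adj v w ∧ t < s.arr 5 (i * n + w))
      (fun t t' htt' h => ?_) (fun t _ h => ?_) (fun t _ h => ?_) t
    · rcases h with h | ⟨w, hw, hvw, h⟩
      · exact Or.inl (by omega)
      · exact Or.inr ⟨w, hw, hvw, by omega⟩
    · rcases h with h | h
      · omega
      · have := mt ((hn 0 t).2).1 (not_not.2 h)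
        omega
    · rw [not_or] at h
      rw [((hn 0 t).2).2 h.2]
      omega

/-- The intervals in the arrays `1` and `2` form a box representation of dimension `d`. -/
def Holds (G : SimpleGraph (Fin n)) (d : ℕ) (s : Store) : Prop :=
  ∀ u v : Fin n, (u = v ∨ G.Adj u v) ↔ ∀ i : Fin d,
    s.arr 1 (i * n + u) ≤ s.arr 2 (i * n + v) ∧ s.arr 1 (i * n + v) ≤ s.arr 2 (i * n + u)

open Classical in
theorem meetTm_ok (hs : Ready G A s) {d : ℕ} (hd : d ≤ W) (h6 : s.reg 6 = d) {u v : Fin n}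
    (h20 : s.reg 20 = u) (h21 : s.reg 21 = v) :
    meetTm.Fits n W s ∧ meetTm.eval s = if ∀ i : Fin d,
      s.arr 1 (i * n + u) ≤ s.arr 2 (i * n + v) ∧ s.arr 1 (i * n + v) ≤ s.arr 2 (i * n + u)
      then 1 else 0 := by
  constructor
  · refine ⟨trivial, trivial, h6.le.trans hd, fun i hi => ?_⟩
    have : i ≤ W := (show i < d from lt_of_lt_of_eq hi h6).le.trans hd
    refine ⟨⟨idxTm_fits trivial trivial ?_, idxTm_fits trivial trivial ?_⟩,
      idxTm_fits trivial trivial ?_, idxTm_fits trivial trivial ?_⟩ <;> simpa [Tm.eval] using this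
  · have key : (∑ i ∈ Finset.range d,
        ((s.arr 1 (i * n + u) - s.arr 2 (i * n + v)) + (s.arr 1 (i * n + v) - s.arr 2 (i * n + u)))
          = 0) ↔ ∀ i : Fin d, s.arr 1 (i * n + u) ≤ s.arr 2 (i * n + v) ∧
            s.arr 1 (i * n + v) ≤ s.arr 2 (i * n + u) := by
      rw [Finset.sum_eq_zero_iff]
      constructor
      · intro h i
        have := h i (Finset.mem_range.2 i.2)
        omega
      · intro h i hi
        have := h ⟨i, Finset.mem_range.1 hi⟩
        simp only at this
        omega
    have he : meetTm.eval s = 1 - ∑ i ∈ Finset.range d,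
        ((s.arr 1 (i * n + u) - s.arr 2 (i * n + v)) +
          (s.arr 1 (i * n + v) - s.arr 2 (i * n + u))) := by
      simp [meetTm, Tm.eval, idxTm_eval, h6, h20, h21, hs.size]
    rw [he]
    split_ifs with h
    · rw [key.2 h]
    · have := mt key.1 h
      omega

open Classical in
-- The two truncated differences add up to the distance of the indicators, so the double sum
-- vanishes iff meeting and adjacency agree on all pairs.
theorem checkTm_ok (hs : Ready G A s) {d : ℕ} (hd : d ≤ W) (h6 : s.reg 6 = d) :
    checkTm.Fits n W s ∧ checkTm.eval s = if Holds G d s then 1 else 0 := by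
  have hmeet : ∀ u v : Fin n, _ := fun u v => meetTm_ok (W := W)
    ((hs.setReg (x := 20) (by decide) u).setReg (x := 21) (by decide) v) hd (by simpa using h6)
    (u := u) (v := v) (by simp) (by simp)
  have hadj : ∀ u v : Fin n, adjEqTm.eval ((s.setReg 20 u).setReg 21 v) =
      if u = v ∨ G.Adj u v then 1 else 0 := by
    intro u v
    have hs' := (hs.setReg (x := 20) (by decide) u).setReg (x := 21) (by decide) v
    rw [adjEqTm, Tm.eval, hs'.adjTm_eval (u := u) (v := v) (by simp [Tm.eval]) (by simp [Tm.eval]),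
      eqTm_eval (u := u) (v := v) (by simp [Tm.eval]) (by simp [Tm.eval])]
    by_cases huv : u = v
    · simp [huv]
    · simp [huv]
  have h0 := hs.size
  constructor
  · refine ⟨trivial, trivial, h0.le, fun u hu => ⟨trivial, ?_, fun v hv => ?_⟩⟩
    · simpa [Tm.eval] using h0.le
    · have hu : u < n := lt_of_lt_of_eq hu h0
      have hv : v < n := by simpa [Tm.eval, h0] using hv
      have hm := (hmeet ⟨u, hu⟩ ⟨v, hv⟩).1
      have ha : adjEqTm.Fits n W ((s.setReg 20 u).setReg 21 v) := by
        simp [adjEqTm, adjTm, eqTm, Tm.Fits]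
      exact ⟨⟨ha, hm⟩, hm, ha⟩
  · have he : checkTm.eval s = 1 - ∑ u : Fin n, ∑ v : Fin n,
        ((adjEqTm.eval ((s.setReg 20 u).setReg 21 v) - meetTm.eval ((s.setReg 20 u).setReg 21 v)) +
        (meetTm.eval ((s.setReg 20 u).setReg 21 v) -
          adjEqTm.eval ((s.setReg 20 u).setReg 21 v))) := by
      simp [checkTm, Tm.eval, h0, Finset.sum_range]
    have key : (∑ u : Fin n, ∑ v : Fin n,
        ((adjEqTm.eval ((s.setReg 20 u).setReg 21 v) - meetTm.eval ((s.setReg 20 u).setReg 21 v)) +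
        (meetTm.eval ((s.setReg 20 u).setReg 21 v) -
          adjEqTm.eval ((s.setReg 20 u).setReg 21 v))) = 0) ↔ Holds G d s := by
      simp only [Finset.sum_eq_zero_iff, Finset.mem_univ, true_implies]
      refine forall₂_congr fun u v => ?_
      rw [(hmeet u v).2, hadj u v]
      simp only [Store.setReg_arr]
      split_ifs with h₁ h₂ h₂ <;> simp only [h₁, h₂] <;> simp
    rw [he]
    split_ifs with h
    · rw [key.2 h]
    · have := mt key.1 h
      omega

end Terms

/-! ### Testing one candidate and searching through all of them -/

section Search

variable {n : ℕ} {G : SimpleGraph (Fin n)} {A : Finset (Fin n)} {W : ℕ} {s : Store}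

theorem Agree.eq {a b : ℕ} {s s' : Store} (h : Agree a s s') (hb : b ≠ a) (t : ℕ) :
    s'.arr b t = s.arr b t := by
  rw [h.arr b hb]

theorem rank_add_lt {d : ℕ} (hd : d ≤ A.card) (i : Fin d) (v : Fin n) :
    rank A v + i * A.card + d * A.card < (A.card + 1) * (A.card + A.card) := by
  have h₁ := rank_le A v
  have h₂ : (i + 1) * A.card ≤ A.card * A.card := Nat.mul_le_mul_right _ (i.2.trans_le hd)
  have h₃ : d * A.card ≤ A.card * A.card := Nat.mul_le_mul_right _ hd
  have h₄ : 0 < A.card := by have := i.2; omega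
  have h₅ : (A.card + 1) * (A.card + A.card) =
    A.card * A.card + A.card * A.card + A.card + A.card := by ring
  rw [Nat.succ_mul] at h₂
  omega

/-- Trying the candidate `c` in dimension `d` yields a box representation, or shows that `c` does
not encode one. -/
theorem tryCmd_ok (hW : Ample A.card W) (hs : Ready G A s) {d c : ℕ} (hd : d ≤ A.card)
    (h6 : s.reg 6 = d) (h8 : s.reg 8 = c) (hc : c ≤ W) :
    tryCmd.Ok n W s fun s' => Ready G A s' ∧ s'.reg 6 = d ∧ s'.reg 13 = d ∧
      ((s'.reg 12 = 1 ∧ Holds G d s') ∨ (s'.reg 12 = 0 ∧ ∃ L R : Fin d → Fin n → ℕ,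
        IsExtension G A d (2 * A.card) (4 * A.card + 1) (leftDigit A d c) (rightDigit A d c) L R ∧
          ¬ ∀ u v, (u = v ∨ G.Adj u v) ↔ ∀ i, L i u ≤ R i v ∧ L i v ≤ R i u)) := by
  classical
  have hdW : d ≤ W := by
    have := hW.succ
    omega
  have reg6 : ∀ {a s s'}, Agree a s s' → s.reg 6 = d → s'.reg 6 = d := fun h h6 =>
    (h.reg 6 (by decide) (by decide)).trans h6
  have reg8 : ∀ {a s s'}, Agree a s s' → s.reg 8 = c → s'.reg 8 = c := fun h h8 =>
    (h.reg 8 (by decide) (by decide)).trans h8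
  refine Cmd.Ok.seq ((tabCmd_ok hs.size h6 hdW (fun i v x => x = leftDigit A d c i v)
    fun s' h' i v h10 h11 => ?_).mono ?_)
  · have hr := hs.agree h' (by decide)
    have := digitTm_ok hr (t := leftPosTm) (T := rank A v + i * A.card) (W := W)
      (lt_of_le_of_lt (Nat.le_add_right _ _) (rank_add_lt hd i v)) (by rw [reg8 h' h8]; exact hc)
      fun j y => leftPosTm_ok ((hr.setReg (x := 20) (by decide) j).setReg (x := 21) (by decide) y)
        hdW (by simpa using h10) (by simpa using h11)
    rwa [reg8 h' h8] at this
  rintro s₁ ⟨a₁, t₁⟩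
  have r₁ := hs.agree a₁ (by decide)
  have h6₁ := reg6 a₁ h6
  refine Cmd.Ok.seq ((tabCmd_ok r₁.size h6₁ hdW (fun i v x => x = rightDigit A d c i v)
    fun s' h' i v h10 h11 => ?_).mono ?_)
  · have hr := r₁.agree h' (by decide)
    have h8' := reg8 h' (reg8 a₁ h8)
    have := digitTm_ok hr (t := rightPosTm) (T := rank A v + i * A.card + d * A.card) (W := W)
      (rank_add_lt hd i v) (by rw [h8']; exact hc)
      fun j y => rightPosTm_ok ((hr.setReg (x := 20) (by decide) j).setReg (x := 21) (by decide) y)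
        hdW (by simpa using reg6 h' h6₁) (by simpa using h10) (by simpa using h11)
    rwa [h8'] at this
  rintro s₂ ⟨a₂, t₂⟩
  have r₂ := r₁.agree a₂ (by decide)
  have h6₂ := reg6 a₂ h6₁
  have u₂ : ∀ (i : Fin d) (v : Fin n), s₂.arr 5 (i * n + v) = leftDigit A d c i v := fun i v => by
    rw [a₂.eq (by decide), t₁]
  refine Cmd.Ok.seq ((tabCmd_ok r₂.size h6₂ hdW (fun i v x => (v ∈ A → x = leftDigit A d c i v) ∧
    (v ∉ A → ∀ t, t < x ↔ t < 2 * A.card ∧ ∀ w ∈ A, G.Adj v w → t < rightDigit A d c i w))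
    fun s' h' i v h10 h11 => ?_).mono ?_)
  · have := leftTm_ok hW (r₂.agree h' (by decide)) hdW h10 h11
    simpa only [h'.eq (b := 5) (by decide), h'.eq (b := 6) (by decide), t₂, u₂] using this
  rintro s₃ ⟨a₃, t₃⟩
  have r₃ := r₂.agree a₃ (by decide)
  have h6₃ := reg6 a₃ h6₂
  refine Cmd.Ok.seq ((tabCmd_ok r₃.size h6₃ hdW (fun i v x => (v ∈ A → x = rightDigit A d c i v) ∧
    (v ∉ A → ∀ t, t < x ↔ t < 4 * A.card + 1 ∧
      (t < 2 * A.card ∨ ∃ w ∈ A, G.Adj v w ∧ t < leftDigit A d c i w)))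
    fun s' h' i v h10 h11 => ?_).mono ?_)
  · have := rightTm_ok hW (r₃.agree h' (by decide)) hdW h10 h11
    simpa only [h'.eq (b := 5) (by decide), h'.eq (b := 6) (by decide), a₃.eq (b := 5) (by decide),
      a₃.eq (b := 6) (by decide), t₂, u₂] using this
  rintro s₄ ⟨a₄, t₄⟩
  have r₄ := r₃.agree a₄ (by decide)
  have h6₄ := reg6 a₄ h6₃
  obtain ⟨f, e⟩ := checkTm_ok r₄ hdW h6₄
  refine Cmd.Ok.seq (Cmd.Ok.set f (Cmd.Ok.set trivial ⟨(r₄.setReg (by decide) _).setReg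
    (by decide) _, by simpa using h6₄, by simpa [Tm.eval] using h6₄, ?_⟩))
  by_cases h : Holds G d s₄
  · exact Or.inl ⟨by simp [e, h], h⟩
  · refine Or.inr ⟨by simp [e, h], fun i v => s₄.arr 1 (i * n + v), fun i v => s₄.arr 2 (i * n + v),
      ⟨fun i v hv => ?_, fun i v => (t₄ i v).1, fun i v hv => ?_, fun i v => (t₄ i v).2⟩, h⟩
    · rw [a₄.eq (by decide)]
      exact (t₃ i v).1 hv
    · rw [a₄.eq (by decide)]
      exact (t₃ i v).2 hv

/-- There is a box representation of dimension `d`. -/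
def HasRep (G : SimpleGraph (Fin n)) (d : ℕ) : Prop :=
  ∃ l r : Fin d → Fin n → ℝ, IsBoxRep G d l r

/-- A box representation of least dimension has been found. -/
def Found (G : SimpleGraph (Fin n)) (s : Store) : Prop :=
  s.reg 12 = 1 ∧ Holds G (s.reg 13) s ∧ ∀ d < s.reg 13, ¬ HasRep G d

theorem Found.setReg (h : Found G s) {x : ℕ} (h12 : x ≠ 12) (h13 : x ≠ 13) (v : ℕ) :
    Found G (s.setReg x v) := by
  have e₁ : (s.setReg x v).reg 12 = s.reg 12 := by simp [h12.symm]
  have e₂ : (s.setReg x v).reg 13 = s.reg 13 := by simp [h13.symm]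
  unfold Found
  rw [e₁, e₂]
  exact h

/-- Dimensions are tried in increasing order. If every candidate of a dimension fails,
`exists_candidate` rules that dimension out, so the first success is optimal; dimension `A.card`
cannot fail. -/
theorem searchCmd_ok (hA : ∀ u v, u ∉ A → v ∉ A → u ≠ v → G.Adj u v) (hW : Ample A.card W)
    (hs : Ready G A s) (h12 : s.reg 12 = 0) :
    searchCmd.Ok n W s fun s' => Found G s' := by
  refine Cmd.Ok.loop (fun d s' => Ready G A s' ∧ ((s'.reg 12 = 0 ∧ ∀ d' < d, ¬ HasRep G d') ∨
    Found G s')) ⟨trivial, trivial⟩ ?_ ⟨hs, Or.inl ⟨h12, fun _ h => absurd h (Nat.not_lt_zero _)⟩⟩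
    ?_ ?_
  · simpa [Tm.eval, hs.card] using hW.succ
  · rintro d hd s₁ ⟨r₁, h₁⟩
    have hd : d ≤ A.card := by
      simp only [Tm.eval, hs.card] at hd
      omega
    have hr := r₁.setReg (x := 6) (by decide) d
    have h6 : (s₁.setReg 6 d).reg 6 = d := by simp
    have hdL : d * (A.card + A.card) ≤ (A.card + 1) * (A.card + A.card) :=
      Nat.mul_le_mul_right _ (by omega)
    have hN : (Tm.get 7 (.sum false 20 (.var 6) (.add (.var 4) (.var 4)))).eval (s₁.setReg 6 d) =
        (4 * A.card + 1) ^ (d * (A.card + A.card)) := by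
      rw [← hr.pow _ hdL]
      simp [Tm.eval, r₁.card]
    have hNW := hW.pow _ hdL
    refine Cmd.Ok.loop (fun c s' => Ready G A s' ∧ s'.reg 6 = d ∧ ((s'.reg 12 = 0 ∧
      (∀ d' < d, ¬ HasRep G d') ∧ ∀ c' < c, ∃ L R : Fin d → Fin n → ℕ,
        IsExtension G A d (2 * A.card) (4 * A.card + 1) (leftDigit A d c') (rightDigit A d c') L R ∧
          ¬ ∀ u v, (u = v ∨ G.Adj u v) ↔ ∀ i, L i u ≤ R i v ∧ L i v ≤ R i u) ∨ Found G s'))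
      ⟨trivial, ?_, fun _ _ => ⟨trivial, trivial⟩⟩ (hN.le.trans hNW) ⟨hr, h6, ?_⟩ ?_ ?_
    · have := hW.succ
      simp only [Tm.eval, h6, cond_false]
      omega
    · rcases h₁ with h | h
      · exact Or.inl ⟨by simpa using h.1, h.2, fun _ h => absurd h (Nat.not_lt_zero _)⟩
      · exact Or.inr (h.setReg (by decide) (by decide) d)
    · rintro c hc s₂ ⟨r₂, h6₂, h₂⟩
      have hcW : c ≤ W := by
        rw [hN] at hc
        omega
      have r₃ := r₂.setReg (x := 8) (by decide) c
      have h6₃ : (s₂.setReg 8 c).reg 6 = d := by simpa using h6₂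
      have h8₃ : (s₂.setReg 8 c).reg 8 = c := by simp
      have h12₃ : (s₂.setReg 8 c).reg 12 = s₂.reg 12 := by simp
      have hF : Found G s₂ → Found G (s₂.setReg 8 c) := fun h => h.setReg (by decide) (by decide) c
      generalize s₂.setReg 8 c = s₃ at *
      -- The invariant treats the loop as a conditional: before its only round the store is
      -- unchanged, afterwards the outcome of `tryCmd` holds.
      refine Cmd.Ok.loop (fun z s' => (z = 0 ∧ s' = s₃) ∨ (0 < z ∧ s₃.reg 12 = 0 ∧ Ready G A s' ∧
        s'.reg 6 = d ∧ s'.reg 13 = d ∧ ((s'.reg 12 = 1 ∧ Holds G d s') ∨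
        (s'.reg 12 = 0 ∧ ∃ L R : Fin d → Fin n → ℕ, IsExtension G A d (2 * A.card)
          (4 * A.card + 1) (leftDigit A d c) (rightDigit A d c) L R ∧
          ¬ ∀ u v, (u = v ∨ G.Adj u v) ↔ ∀ i, L i u ≤ R i v ∧ L i v ≤ R i u))))
        ⟨trivial, trivial⟩ ?_ (Or.inl ⟨rfl, rfl⟩) ?_ ?_
      · have := hW.succ
        simp only [Tm.eval, cond_false]
        omega
      · intro z hz s₄ h₄
        simp only [Tm.eval] at hz
        rcases h₄ with ⟨rfl, rfl⟩ | ⟨hz', -⟩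
        · exact (tryCmd_ok hW (r₃.setReg (by decide) 0) hd (by simpa using h6₃)
            (by simpa using h8₃) hcW).mono fun s' h => Or.inr ⟨by omega, by omega, h⟩
        · omega
      · intro s₄ h₄
        simp only [Tm.eval] at h₄
        rcases h₂ with ⟨h12₂, hlt, hbad⟩ | hfound
        · rcases h₄ with ⟨h0, rfl⟩ | ⟨-, -, r₄, h6₄, h13₄, h₄ | ⟨h12₄, h₄⟩⟩
          · omega
          · refine ⟨r₄, h6₄, Or.inr ⟨h₄.1, ?_⟩⟩
            rw [h13₄]
            exact ⟨h₄.2, hlt⟩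
          · refine ⟨r₄, h6₄, Or.inl ⟨h12₄, hlt, fun c' hc' => ?_⟩⟩
            rcases Nat.lt_succ_iff_lt_or_eq.1 hc' with h | rfl
            · exact hbad c' h
            · exact h₄
        · rcases h₄ with ⟨-, rfl⟩ | ⟨-, h0, -⟩
          · exact ⟨r₃, h6₃, Or.inr (hF hfound)⟩
          · have := hfound.1
            omega
    · rintro s₂ ⟨r₂, -, h₂⟩
      refine ⟨r₂, h₂.imp (fun ⟨h12₂, hlt, hbad⟩ => ⟨h12₂, fun d' hd' => ?_⟩) id⟩
      rcases Nat.lt_succ_iff_lt_or_eq.1 hd' with h | rfl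
      · exact hlt d' h
      · intro hrep
        obtain ⟨c, hc, hgood⟩ := exists_candidate G A hA hrep
        obtain ⟨L, R, hext, hnot⟩ := hbad c (hN ▸ hc)
        exact hnot (hgood L R hext)
  · rintro s₁ ⟨-, ⟨-, h⟩ | h⟩
    · refine absurd (exists_isBoxRep_card G A hA) (h A.card ?_)
      simp [Tm.eval, hs.card]
    · exact h

end Search

/-! ### The running time -/

/-- A bound on the numbers of rounds that depend on the number `m` of marked vertices only. -/
def roundBound (m : ℕ) : ℕ := (4 * m + 2) ^ ((m + 1) * (m + m) + 1)

theorem ample_roundBound (m : ℕ) : Ample m (roundBound m) := by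
  have h₁ : 4 * m + 2 ≤ roundBound m := Nat.le_self_pow (by omega) _
  have h₂ : (m + 1) * (m + m) + 1 < roundBound m := Nat.lt_pow_self (by omega)
  refine ⟨by omega, by omega, by omega, fun t ht => ?_⟩
  exact (Nat.pow_le_pow_left (by omega) t).trans (Nat.pow_le_pow_right (by omega) (by omega))

theorem roundBound_mono {m m' : ℕ} (h : m ≤ m') : roundBound m ≤ roundBound m' := by
  unfold roundBound
  refine (Nat.pow_le_pow_left (by omega) _).trans (Nat.pow_le_pow_right (by omega) ?_)
  gcongr

/-- For `k ≥ 2` the base is at most `k ^ 5` and the exponent at most `11 * k ^ 2`, whence `55`. -/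
theorem roundBound_two_mul_le {k : ℕ} (hk : 2 ≤ k) : roundBound (2 * k) ≤ k ^ (55 * k ^ 2) := by
  have h₁ : 4 * (2 * k) + 2 ≤ k ^ 5 := by
    have : 2 ^ 4 ≤ k ^ 4 := Nat.pow_le_pow_left hk 4
    calc 4 * (2 * k) + 2 ≤ 2 ^ 4 * k := by omega
      _ ≤ k ^ 4 * k := Nat.mul_le_mul_right k this
      _ = k ^ 5 := by ring
  have h₂ : (2 * k + 1) * (2 * k + 2 * k) + 1 ≤ 11 * k ^ 2 := by nlinarith
  calc roundBound (2 * k) ≤ (k ^ 5) ^ ((2 * k + 1) * (2 * k + 2 * k) + 1) :=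
        Nat.pow_le_pow_left h₁ _
    _ ≤ (k ^ 5) ^ (11 * k ^ 2) := Nat.pow_le_pow_right (by positivity) h₂
    _ = k ^ (55 * k ^ 2) := by rw [← pow_mul]; ring_nf

theorem exists_time_bound (K D : ℕ) : ∃ C : ℕ, ∀ n m k t : ℕ, m ≤ 2 * k →
    t ≤ K * (n ^ 2 * roundBound m ^ D) →
      (t : ℝ) ≤ C * (n : ℝ) ^ 2 * (2 : ℝ) ^ (C * (k : ℝ) ^ 2 * Real.logb 2 k) := by
  -- The first summand settles `k ≤ 1`, where the logarithm is `0` and `m ≤ 2`; the second is the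
  -- exponent needed for `k ≥ 2`.
  refine ⟨K * roundBound 2 ^ D + 55 * D, fun n m k t hm ht => ?_⟩
  set C := K * roundBound 2 ^ D + 55 * D with hC
  have hr := ht.trans (Nat.mul_le_mul_left K (Nat.mul_le_mul_left (n ^ 2)
    (Nat.pow_le_pow_left (roundBound_mono hm) D)))
  rcases Nat.lt_or_ge k 2 with hk | hk
  · have hlog : Real.logb 2 k = 0 := by
      interval_cases k <;> simp
    have h₁ : K * (n ^ 2 * roundBound (2 * k) ^ D) ≤ C * n ^ 2 := by
      have h₂ := Nat.pow_le_pow_left (roundBound_mono (m := 2 * k) (m' := 2) (by omega)) D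
      calc K * (n ^ 2 * roundBound (2 * k) ^ D) = K * roundBound (2 * k) ^ D * n ^ 2 := by ring
        _ ≤ (K * roundBound 2 ^ D) * n ^ 2 := by gcongr
        _ ≤ C * n ^ 2 := Nat.mul_le_mul_right _ (by omega)
    rw [hlog, mul_zero, Real.rpow_zero, mul_one]
    exact_mod_cast hr.trans h₁
  · have hpow : (2 : ℝ) ^ (C * (k : ℝ) ^ 2 * Real.logb 2 k) = (k : ℝ) ^ (C * k ^ 2) := by
      rw [mul_comm, Real.rpow_mul (by norm_num), Real.rpow_logb (by norm_num) (by norm_num)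
        (by positivity)]
      exact_mod_cast Real.rpow_natCast (k : ℝ) (C * k ^ 2)
    have hK : K ≤ C := by
      have : 0 < roundBound 2 ^ D := by unfold roundBound; positivity
      have := Nat.le_mul_of_pos_right K this
      omega
    have h₁ : K * (n ^ 2 * roundBound (2 * k) ^ D) ≤ C * n ^ 2 * k ^ (C * k ^ 2) := by
      rw [← mul_assoc]
      refine Nat.mul_le_mul (Nat.mul_le_mul_right _ hK) ?_
      calc roundBound (2 * k) ^ D ≤ (k ^ (55 * k ^ 2)) ^ D :=
            Nat.pow_le_pow_left (roundBound_two_mul_le hk) D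
        _ = k ^ (55 * D * k ^ 2) := by rw [← pow_mul]; ring_nf
        _ ≤ k ^ (C * k ^ 2) := Nat.pow_le_pow_right (by omega) (Nat.mul_le_mul_right _ (by omega))
    rw [hpow]
    exact_mod_cast hr.trans h₁

theorem HalfFree.card_le {n : ℕ} {G : SimpleGraph (Fin n)} {A : Finset (Fin n)} (h : HalfFree G A)
    {k : ℕ} {S : Finset (Fin n)} (hS : G.IsClique (S : Set (Fin n))) (hk : n ≤ S.card + k) :
    A.card ≤ 2 * k := by
  have h₁ := h S hS
  have h₂ : (A \ S).card ≤ (Sᶜ).card := Finset.card_le_card fun x hx => by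
    simp only [Finset.mem_sdiff] at hx
    simpa using hx.2
  rw [Finset.card_compl, Fintype.card_fin] at h₂
  omega

theorem boxCmd_ok {n : ℕ} (G : SimpleGraph (Fin n)) : ∃ A : Finset (Fin n), HalfFree G A ∧
    boxCmd.Ok n (roundBound A.card) (inputStore G) (HoldsOptimalBoxRep G) := by
  -- The effect of a command does not depend on `W`. An arbitrary value serves to obtain `A`, after
  -- which `W` is chosen from its size.
  obtain ⟨-, hp, h3⟩ := rowCmd_ok G 0
  obtain ⟨-, hp', A, hA, hhalf, hclique⟩ := markCmd_ok (W := 0) hp h3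
  refine ⟨A, hhalf, Cmd.Ok.seq ⟨(rowCmd_ok G _).1, Cmd.Ok.seq ⟨(markCmd_ok hp h3).1,
    sizeCmd_powCmd_ok (ample_roundBound _) hp' hA fun s hs h12 => Cmd.Ok.seq
      ((searchCmd_ok hclique (ample_roundBound _) hs h12).mono fun s' hs' =>
        Cmd.Ok.set trivial ?_)⟩⟩⟩
  obtain ⟨-, hholds, hlt⟩ := hs'
  have hrep : IsBoxRep G (s'.reg 13) (fun i v => (s'.arr 1 ((i : ℕ) * n + v) : ℝ))
      (fun i v => (s'.arr 2 ((i : ℕ) * n + v) : ℝ)) := (isBoxRep_natCast_iff G _ _ _).2 hholds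
  have hreg : (s'.setReg 0 ((Tm.var 13).eval s')).reg 0 = s'.reg 13 := by simp [Tm.eval]
  unfold HoldsOptimalBoxRep
  rw [hreg]
  exact ⟨(boxicity_eq ⟨_, _, hrep⟩ hlt).symm, hrep⟩

end Boxicity

theorem theorem1 :
    (∀ (V : Type*) [Fintype V] (G : SimpleGraph V) (k : ℕ) (S : Finset V),
      G.IsClique (S : Set V) → Fintype.card V ≤ S.card + k → Boxicity.boxicity G ≤ k) ∧
    ∃ (P : Boxicity.Prog) (C : ℕ), ∀ (n : ℕ), 0 < n → ∀ G : SimpleGraph (Fin n),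
      ∃ (t : ℕ) (s : Boxicity.Store),
        Boxicity.Run P (Boxicity.inputStore G) t s ∧
        Boxicity.HoldsOptimalBoxRep G s ∧
        ∀ (k : ℕ) (S : Finset (Fin n)), G.IsClique (S : Set (Fin n)) → n ≤ S.card + k →
          (t : ℝ) ≤ C * (n : ℝ) ^ 2 * (2 : ℝ) ^ (C * (k : ℝ) ^ 2 * Real.logb 2 k) := by
  open Boxicity in
  refine ⟨fun V _ G k S hS hk => boxicity_le G k S hS hk, ?_⟩
  obtain ⟨C, hC⟩ := exists_time_bound boxCmd.coef (boxCmd.deg false)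
  refine ⟨boxCmd.code 0, C, fun n hn G => ?_⟩
  obtain ⟨A, hhalf, hfits, hopt⟩ := boxCmd_ok G
  -- Variable `0` is held in register `2 * 0 = 0` and all other registers start at `0`, so the input
  -- store represents itself, and the output register is the required one.
  obtain ⟨t, s, hrun, hsim, -, ht⟩ := boxCmd.run_code n (roundBound A.card) (j := 0)
    boxCmd_inScope (M := inputStore G) (s := inputStore G)
    ⟨rfl, fun x _ => by simp [inputStore]⟩ hfits
  refine ⟨t, s, hrun, ?_, fun k S hS hk => hC n A.card k t (hhalf.card_le hS hk) ?_⟩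
  · have h0 := hsim.reg 0 (by decide)
    unfold HoldsOptimalBoxRep at hopt ⊢
    rw [hsim.arr, show s.reg 0 = _ from h0]
    exact hopt
  · have := ht.trans (boxCmd.bound_le hn (by unfold roundBound; positivity))
    rwa [boxCmd_deg] at this
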